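/- Let $\mathbb K$ be an algebraically closed field, $n>2$ an integer and $q\in\mathbb K$ a primitive $n$-th root of unity. Let $H_n(0,q)$ be the Hopf algebra over $\mathbb K$ generated as an algebra by $a,b,c,d$ subject to the relations $$ba=qab,\quad db=qbd,\quad ca=qac,\quad dc=qcd,\quad bc=cb,\quad a^n=d^n=0,\quad b^n=c^n=1,\quad da=qad,$$ with comultiplication, counit and antipode determined by $$\Delta(a)=a\otimes b+1\otimes a,\quad \Delta(b)=b\otimes b,\quad \Delta(c)=c\otimes c,\quad \Delta(d)=d\otimes c+1\otimes d,$$ $$\varepsilon(a)=\varepsilon(d)=0,\quad \varepsilon(b)=\varepsilon(c)=1,\quad S(a)=-ab^{n-1},\quad S(b)=b^{n-1},\quad S(c)=c^{n-1},\quad S(d)=-dc^{n-1}.$$ The Green ring $r(H)$ of a Hopf algebra $H$ is the abelian group generated by the isomorphism classes $[M]$ of finite-dimensional left $H$-modules modulo the relations $[M\oplus V]=[M]+[V]$, with multiplication $[M][V]=[M\otimes V]$; the projective class ring $r_p(H)$ is the subring of $r(H)$ generated by the classes of the projective modules and of the simple modules. For $i,j\in\mathbb Z/n\mathbb Z$ let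 $S_{i,j}$ be the one-dimensional $H_n(0,q)$-module on which $a$ and $d$ act as $0$, $b$ acts as $q^i$ and $c$ acts as $q^j$; $S_{0,0}$ has a finite-dimensional projective cover, and $P_{0,0}$ denotes any such cover. Then there is a ring isomorphism $$\mathbb Z[x,y,z]\Big/\Big(x^n-1,\ y^n-1,\ z^2-n\sum_{i=0}^{n-1}x^iz\Big)\ \cong\ r_p(H_n(0,q))$$ that sends $x$, $y$ and $z$ to $[S_{1,1}]$, $[S_{0,1}]$ and $[P_{0,0}]$, respectively. -/

import Mathlib

open scoped TensorProduct

universe u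

/-! ## The `q`-binomial formula at a root of unity

It is used only to see that the comultiplication below respects `a ^ n = 0` and `d ^ n = 0`. -/

namespace QBinomial

/-- Gaussian binomial coefficients evaluated at `q`. -/
def gauss {K : Type u} [Field K] (q : K) : ℕ → ℕ → K
  | _, 0 => 1
  | 0, _ + 1 => 0
  | m + 1, k + 1 => gauss q m k + q ^ (k + 1) * gauss q m (k + 1)

theorem gauss_zero_right {K : Type u} [Field K] (q : K) (m : ℕ) : gauss q m 0 = 1 := by
  cases m <;> rfl

theorem gauss_succ {K : Type u} [Field K] (q : K) (m k : ℕ) :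
    gauss q (m + 1) (k + 1) = gauss q m k + q ^ (k + 1) * gauss q m (k + 1) := rfl

theorem gauss_of_lt {K : Type u} [Field K] (q : K) (m : ℕ) :
    ∀ k, m < k → gauss q m k = 0 := by
  induction m with
  | zero =>
    intro k hk
    obtain ⟨j, rfl⟩ : ∃ j, k = j + 1 := ⟨k - 1, by omega⟩
    rfl
  | succ m ih =>
    intro k hk
    obtain ⟨j, rfl⟩ : ∃ j, k = j + 1 := ⟨k - 1, by omega⟩
    rw [gauss_succ, ih j (by omega), ih (j + 1) (by omega)]
    simp

theorem gauss_absorb {K : Type u} [Field K] (q : K) (m : ℕ) :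
    ∀ k, gauss q (m + 1) (k + 1) * (q ^ (k + 1) - 1) = (q ^ (m + 1) - 1) * gauss q m k := by
  induction m with
  | zero =>
    intro k
    rcases k with _ | k
    · rw [gauss_succ, gauss_zero_right, gauss_of_lt q 0 1 (by omega)]; ring
    · rw [gauss_of_lt q 1 (k + 2) (by omega), gauss_of_lt q 0 (k + 1) (by omega)]; ring
  | succ m ih =>
    intro k
    rw [gauss_succ q (m + 1) k, add_mul, mul_assoc, ih k]
    rcases k with _ | k
    · rw [gauss_zero_right, gauss_zero_right]; ring
    · have h1 := ih k
      have h2 := gauss_succ q m k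
      have h3 : q ^ (k + 1 + 1) * ((q ^ (m + 1) - 1) * gauss q m (k + 1)) =
          q * (q ^ (m + 1) - 1) * (gauss q (m + 1) (k + 1) - gauss q m k) := by
        rw [h2]; ring
      rw [h3]
      linear_combination q * h1

theorem gauss_primitive {K : Type u} [Field K] {q : K} {n : ℕ} (hq : IsPrimitiveRoot q n)
    {k : ℕ} (h0 : 0 < k) (hk : k < n) : gauss q n k = 0 := by
  obtain ⟨m, rfl⟩ : ∃ m, n = m + 1 := ⟨n - 1, by omega⟩
  obtain ⟨j, rfl⟩ : ∃ j, k = j + 1 := ⟨k - 1, by omega⟩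
  have h := gauss_absorb q m j
  rw [hq.pow_eq_one, sub_self, zero_mul] at h
  rcases mul_eq_zero.mp h with h | h
  · exact h
  · exact absurd (sub_eq_zero.mp h) (hq.pow_ne_one_of_pos_of_lt (by omega) hk)

theorem mul_pow_skew {K : Type u} [Field K] {A : Type u} [Ring A] [Algebra K A] {q : K} {x y : A}
    (h : y * x = q • (x * y)) (k : ℕ) : y * x ^ k = q ^ k • (x ^ k * y) := by
  induction k with
  | zero => simp
  | succ k ih =>
    rw [pow_succ, ← mul_assoc, ih, smul_mul_assoc, mul_assoc, h, mul_smul_comm, smul_smul,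
      pow_succ, mul_assoc]

theorem add_pow_skew {K : Type u} [Field K] {A : Type u} [Ring A] [Algebra K A] {q : K} {x y : A}
    (h : y * x = q • (x * y)) (m : ℕ) :
    (x + y) ^ m = ∑ k ∈ Finset.range (m + 1), gauss q m k • (x ^ k * y ^ (m - k)) := by
  induction m with
  | zero => simp [gauss_zero_right]
  | succ m ih =>
    rw [pow_succ', ih, add_mul, Finset.mul_sum, Finset.mul_sum]
    have e1 : ∑ k ∈ Finset.range (m + 1), x * gauss q m k • (x ^ k * y ^ (m - k)) =
        ∑ k ∈ Finset.range (m + 1), gauss q m k • (x ^ (k + 1) * y ^ (m - k)) := by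
      refine Finset.sum_congr rfl fun k _ => ?_
      rw [mul_smul_comm, ← mul_assoc, ← pow_succ']
    have e2 : ∑ k ∈ Finset.range (m + 1), y * gauss q m k • (x ^ k * y ^ (m - k)) =
        ∑ k ∈ Finset.range (m + 2), (q ^ k * gauss q m k) • (x ^ k * y ^ (m + 1 - k)) := by
      rw [Finset.sum_range_succ _ (m + 1), gauss_of_lt q m (m + 1) (by omega), mul_zero, zero_smul,
        add_zero]
      refine Finset.sum_congr rfl fun k hk => ?_
      have hk' : k ≤ m := by simpa [Nat.lt_succ_iff] using hk
      rw [mul_smul_comm, ← mul_assoc, mul_pow_skew h, smul_mul_assoc, smul_smul, mul_assoc,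
        ← pow_succ', mul_comm (gauss q m k), show m - k + 1 = m + 1 - k by omega]
    rw [e1, e2, Finset.sum_range_succ' _ (m + 1), Finset.sum_range_succ' _ (m + 1), ← add_assoc,
      ← Finset.sum_add_distrib]
    congr 1
    · refine Finset.sum_congr rfl fun k _ => ?_
      rw [gauss_succ, add_smul, show m + 1 - (k + 1) = m - k by omega]
    · simp [gauss_zero_right]

theorem add_pow_eq_zero {K : Type u} [Field K] {A : Type u} [Ring A] [Algebra K A] {q : K} {n : ℕ}
    (hq : IsPrimitiveRoot q n) {x y : A} (h : y * x = q • (x * y)) (hx : x ^ n = 0)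
    (hy : y ^ n = 0) : (x + y) ^ n = 0 := by
  rw [add_pow_skew h]
  refine Finset.sum_eq_zero fun k hk => ?_
  have hk' : k ≤ n := by simpa [Nat.lt_succ_iff] using hk
  rcases Nat.eq_zero_or_pos k with rfl | h0
  · simp [hy]
  · rcases hk'.lt_or_eq with h1 | rfl
    · rw [gauss_primitive hq h0 h1, zero_smul]
    · simp [hx]

theorem mul_pow_skew_exists {K : Type u} [Field K] {A : Type u} [Ring A] [Algebra K A] {r : K}
    {x y : A} (h : y * x = r • (x * y)) (m : ℕ) : ∃ s : K, (x * y) ^ m = s • (x ^ m * y ^ m) := by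
  induction m with
  | zero => exact ⟨1, by simp⟩
  | succ m ih =>
    obtain ⟨s, hs⟩ := ih
    refine ⟨r ^ m * s, ?_⟩
    rw [pow_succ', hs, mul_smul_comm, mul_assoc, ← mul_assoc y, mul_pow_skew h, smul_mul_assoc,
      mul_smul_comm, smul_smul, mul_comm s, pow_succ' x, pow_succ' y]
    simp only [mul_assoc]

end QBinomial

/-! ## The Hopf algebra `H_n(0,q)` -/

namespace HnZero

/-- The defining relations of `H_n(0,q)` for four elements of a `K`-algebra. -/
structure Relations {K : Type u} [Field K] (n : ℕ) (q : K) {A : Type u} [Ring A] [Algebra K A]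
    (a b c d : A) : Prop where
  ba : b * a = q • (a * b)
  db : d * b = q • (b * d)
  ca : c * a = q • (a * c)
  dc : d * c = q • (c * d)
  bc : b * c = c * b
  an : a ^ n = 0
  bn : b ^ n = 1
  cn : c ^ n = 1
  dn : d ^ n = 0
  da : d * a = q • (a * d)

/-- The names of the four generators. -/
inductive Gen : Type
  | a | b | c | d

open FreeAlgebra in
/-- The relations imposed on the free algebra on `a, b, c, d`. -/
inductive Rel {K : Type u} [Field K] (n : ℕ) (q : K) :
    FreeAlgebra K Gen → FreeAlgebra K Gen → Prop
  | ba : Rel n q (ι K Gen.b * ι K Gen.a) (q • (ι K Gen.a * ι K Gen.b))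
  | db : Rel n q (ι K Gen.d * ι K Gen.b) (q • (ι K Gen.b * ι K Gen.d))
  | ca : Rel n q (ι K Gen.c * ι K Gen.a) (q • (ι K Gen.a * ι K Gen.c))
  | dc : Rel n q (ι K Gen.d * ι K Gen.c) (q • (ι K Gen.c * ι K Gen.d))
  | bc : Rel n q (ι K Gen.b * ι K Gen.c) (ι K Gen.c * ι K Gen.b)
  | an : Rel n q (ι K Gen.a ^ n) 0
  | bn : Rel n q (ι K Gen.b ^ n) 1
  | cn : Rel n q (ι K Gen.c ^ n) 1
  | dn : Rel n q (ι K Gen.d ^ n) 0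
  | da : Rel n q (ι K Gen.d * ι K Gen.a) (q • (ι K Gen.a * ι K Gen.d))

end HnZero

/-- The algebra `H_n(0,q)`: generators `a, b, c, d` and relations
`ba = qab`, `db = qbd`, `ca = qac`, `dc = qcd`, `bc = cb`, `aⁿ = dⁿ = 0`, `bⁿ = cⁿ = 1`,
`da = qad`. -/
def HnZero {K : Type u} [Field K] (n : ℕ) (q : K) : Type u := RingQuot (HnZero.Rel n q)

namespace HnZero

noncomputable section

variable {K : Type u} [Field K] (n : ℕ) (q : K)

instance : Ring (HnZero n q) := inferInstanceAs (Ring (RingQuot (Rel n q)))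

instance instAlgebra : Algebra K (HnZero n q) := inferInstanceAs (Algebra K (RingQuot (Rel n q)))

/-- The image of a generator. -/
def gen (g : Gen) : HnZero n q := RingQuot.mkAlgHom K (Rel n q) (FreeAlgebra.ι K g)

theorem relations :
    Relations n q (gen n q Gen.a) (gen n q Gen.b) (gen n q Gen.c) (gen n q Gen.d) := by
  constructor
  · have h := RingQuot.mkAlgHom_rel K (Rel.ba (n := n) (q := q))
    rw [map_smul, map_mul, map_mul] at h; exact h
  · have h := RingQuot.mkAlgHom_rel K (Rel.db (n := n) (q := q))
    rw [map_smul, map_mul, map_mul] at h; exact h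
  · have h := RingQuot.mkAlgHom_rel K (Rel.ca (n := n) (q := q))
    rw [map_smul, map_mul, map_mul] at h; exact h
  · have h := RingQuot.mkAlgHom_rel K (Rel.dc (n := n) (q := q))
    rw [map_smul, map_mul, map_mul] at h; exact h
  · have h := RingQuot.mkAlgHom_rel K (Rel.bc (n := n) (q := q))
    rw [map_mul, map_mul] at h; exact h
  · have h := RingQuot.mkAlgHom_rel K (Rel.an (n := n) (q := q))
    rw [map_pow, map_zero] at h; exact h
  · have h := RingQuot.mkAlgHom_rel K (Rel.bn (n := n) (q := q))
    rw [map_pow, map_one] at h; exact h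
  · have h := RingQuot.mkAlgHom_rel K (Rel.cn (n := n) (q := q))
    rw [map_pow, map_one] at h; exact h
  · have h := RingQuot.mkAlgHom_rel K (Rel.dn (n := n) (q := q))
    rw [map_pow, map_zero] at h; exact h
  · have h := RingQuot.mkAlgHom_rel K (Rel.da (n := n) (q := q))
    rw [map_smul, map_mul, map_mul] at h; exact h

variable {n q}

/-- The images of the generators under the map of free algebras. -/
def genMap {A : Type u} (a b c d : A) : Gen → A
  | .a => a
  | .b => b
  | .c => c
  | .d => d

/-- The universal property of `H_n(0,q)`. -/
def lift {A : Type u} [Ring A] [Algebra K A] {a b c d : A} (h : Relations n q a b c d) :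
    HnZero n q →ₐ[K] A :=
  RingQuot.liftAlgHom K ⟨FreeAlgebra.lift K (genMap a b c d), by
    rintro _ _ (_ | _)
    · simpa [genMap] using h.ba
    · simpa [genMap] using h.db
    · simpa [genMap] using h.ca
    · simpa [genMap] using h.dc
    · simpa [genMap] using h.bc
    · simpa [genMap] using h.an
    · simpa [genMap] using h.bn
    · simpa [genMap] using h.cn
    · simpa [genMap] using h.dn
    · simpa [genMap] using h.da⟩

@[simp]
theorem lift_gen {A : Type u} [Ring A] [Algebra K A] {a b c d : A} (h : Relations n q a b c d)
    (g : Gen) : lift h (gen n q g) = genMap a b c d g := by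
  unfold lift gen
  erw [RingQuot.liftAlgHom_mkAlgHom_apply]
  simp

theorem hom_ext {A : Type u} [Ring A] [Algebra K A] {f g : HnZero n q →ₐ[K] A}
    (h : ∀ x, f (gen n q x) = g (gen n q x)) : f = g := by
  refine RingQuot.ringQuot_ext' K f g (FreeAlgebra.hom_ext (funext fun x => ?_))
  exact h x

/-- Every subalgebra containing the four generators is everything. -/
theorem eq_top_of_gen_mem (B : Subalgebra K (HnZero n q)) (h : ∀ g, gen n q g ∈ B) : B = ⊤ := by
  have hB : Relations n q (⟨_, h .a⟩ : B) ⟨_, h .b⟩ ⟨_, h .c⟩ ⟨_, h .d⟩ := by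
    have r := relations n q
    exact ⟨Subtype.ext r.ba, Subtype.ext r.db, Subtype.ext r.ca, Subtype.ext r.dc,
      Subtype.ext r.bc, Subtype.ext r.an, Subtype.ext r.bn, Subtype.ext r.cn, Subtype.ext r.dn,
      Subtype.ext r.da⟩
  have e : B.val.comp (lift hB) = AlgHom.id K _ := hom_ext fun x => by
    cases x <;> simp [genMap]
  refine eq_top_iff.mpr fun x _ => ?_
  have := DFunLike.congr_fun e x
  simp only [AlgHom.comp_apply, AlgHom.id_apply] at this
  rw [← this]
  exact (lift hB x).2

open TensorProduct in
theorem relations_comul (hq : IsPrimitiveRoot q n) :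
    Relations n q (A := HnZero n q ⊗[K] HnZero n q)
      (gen n q .a ⊗ₜ gen n q .b + 1 ⊗ₜ gen n q .a) (gen n q .b ⊗ₜ gen n q .b)
      (gen n q .c ⊗ₜ gen n q .c) (gen n q .d ⊗ₜ gen n q .c + 1 ⊗ₜ gen n q .d) := by
  have r := relations n q
  constructor
  · simp only [mul_add, add_mul, Algebra.TensorProduct.tmul_mul_tmul, r.ba, smul_add, mul_one,
      one_mul, tmul_smul, smul_tmul']
  · simp only [mul_add, add_mul, Algebra.TensorProduct.tmul_mul_tmul, r.db, r.bc, smul_add,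
      mul_one, one_mul, tmul_smul, smul_tmul']
  · simp only [mul_add, add_mul, Algebra.TensorProduct.tmul_mul_tmul, r.ca, r.bc, smul_add,
      mul_one, one_mul, tmul_smul, smul_tmul']
  · simp only [mul_add, add_mul, Algebra.TensorProduct.tmul_mul_tmul, r.dc, smul_add,
      mul_one, one_mul, tmul_smul, smul_tmul']
  · simp only [Algebra.TensorProduct.tmul_mul_tmul, r.bc]
  · rw [add_comm]
    refine QBinomial.add_pow_eq_zero hq ?_ ?_ ?_
    · simp only [Algebra.TensorProduct.tmul_mul_tmul, r.ba, mul_one, one_mul, tmul_smul]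
    · rw [Algebra.TensorProduct.tmul_pow, r.an, tmul_zero]
    · rw [Algebra.TensorProduct.tmul_pow, r.an, zero_tmul]
  · rw [Algebra.TensorProduct.tmul_pow, r.bn]; rfl
  · rw [Algebra.TensorProduct.tmul_pow, r.cn]; rfl
  · refine QBinomial.add_pow_eq_zero hq ?_ ?_ ?_
    · simp only [Algebra.TensorProduct.tmul_mul_tmul, r.dc, mul_one, one_mul, tmul_smul]
    · rw [Algebra.TensorProduct.tmul_pow, r.dn, zero_tmul]
    · rw [Algebra.TensorProduct.tmul_pow, r.dn, tmul_zero]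
  · simp only [mul_add, add_mul, Algebra.TensorProduct.tmul_mul_tmul, r.da, r.bc, r.ca, r.db,
      smul_add, mul_one, one_mul, tmul_smul, smul_tmul']
    abel

/-- The scalars `0, s, t, 0` satisfy the relations when `s ^ n = t ^ n = 1`. -/
theorem relations_scalar (hn : n ≠ 0) {s t : K} (hs : s ^ n = 1) (ht : t ^ n = 1) :
    Relations n q (0 : K) s t 0 := by
  constructor <;> simp [hn, hs, ht, mul_comm]

variable [hn : Fact (2 < n)] [hq : Fact (IsPrimitiveRoot q n)]

variable (n q) in
/-- The comultiplication: `Δ(a) = a ⊗ b + 1 ⊗ a`, `Δ(b) = b ⊗ b`, `Δ(c) = c ⊗ c`,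
`Δ(d) = d ⊗ c + 1 ⊗ d`. -/
def comulHom : HnZero n q →ₐ[K] HnZero n q ⊗[K] HnZero n q := lift (relations_comul hq.out)

theorem ne_zero_of_fact : n ≠ 0 := by
  have := hn.out
  omega

variable (n q) in
/-- The counit: `ε(a) = ε(d) = 0`, `ε(b) = ε(c) = 1`. -/
def counitHom : HnZero n q →ₐ[K] K :=
  lift (relations_scalar ne_zero_of_fact (one_pow n) (one_pow n))

instance instBialgebra : Bialgebra K (HnZero n q) :=
  Bialgebra.ofAlgHom (comulHom n q) (counitHom n q)
    (hom_ext fun x => by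
      cases x <;> simp [comulHom, genMap, TensorProduct.add_tmul, TensorProduct.tmul_add,
        Algebra.TensorProduct.one_def, add_assoc])
    (hom_ext fun x => by cases x <;> simp [comulHom, counitHom, genMap])
    (hom_ext fun x => by cases x <;> simp [comulHom, counitHom, genMap])

theorem comul_gen (g : Gen) : Coalgebra.comul (R := K) (gen n q g) =
    genMap (gen n q .a ⊗ₜ[K] gen n q .b + 1 ⊗ₜ[K] gen n q .a) (gen n q .b ⊗ₜ[K] gen n q .b)
      (gen n q .c ⊗ₜ[K] gen n q .c) (gen n q .d ⊗ₜ[K] gen n q .c + 1 ⊗ₜ[K] gen n q .d) g :=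
  lift_gen (relations_comul hq.out) g

theorem counit_gen (g : Gen) : Coalgebra.counit (R := K) (gen n q g) = genMap 0 1 1 0 g :=
  lift_gen (relations_scalar ne_zero_of_fact (one_pow n) (one_pow n)) g

section Antipode

open MulOpposite

variable (n q) in
/-- The elements `S(a) = -a b^{n-1}`, `S(b) = b^{n-1}`, `S(c) = c^{n-1}`, `S(d) = -d c^{n-1}`
satisfy the relations in the opposite algebra. -/
theorem relations_antipode :
    Relations n q (op (-(gen n q .a * gen n q .b ^ (n - 1)))) (op (gen n q .b ^ (n - 1)))
      (op (gen n q .c ^ (n - 1))) (op (-(gen n q .d * gen n q .c ^ (n - 1)))) := by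
  have hn0 : n ≠ 0 := ne_zero_of_fact
  have r := relations n q
  generalize gen n q .a = a, gen n q .b = b, gen n q .c = c, gen n q .d = d at r
  obtain ⟨β, hβ⟩ : ∃ β, β = b ^ (n - 1) := ⟨_, rfl⟩
  obtain ⟨γ, hγ⟩ : ∃ γ, γ = c ^ (n - 1) := ⟨_, rfl⟩
  rw [← hβ, ← hγ]
  have b1 : b * β = 1 := by rw [hβ, mul_pow_sub_one hn0, r.bn]
  have b2 : β * b = 1 := by rw [hβ, pow_sub_one_mul hn0, r.bn]
  have c1 : c * γ = 1 := by rw [hγ, mul_pow_sub_one hn0, r.cn]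
  have c2 : γ * c = 1 := by rw [hγ, pow_sub_one_mul hn0, r.cn]
  have βγ : β * γ = γ * β := by
    rw [hβ, hγ]; exact ((show Commute b c from r.bc).pow_pow _ _).eq
  have βn : β ^ n = 1 := by rw [hβ, ← pow_mul, mul_comm, pow_mul, r.bn, one_pow]
  have γn : γ ^ n = 1 := by rw [hγ, ← pow_mul, mul_comm, pow_mul, r.cn, one_pow]
  have conj : ∀ (u v w : HnZero n q), u * v = 1 → v * u = 1 → u * w = q • (w * u) →
      w * v = q • (v * w) := by
    intro u v w h1 h2 h
    calc w * v = v * (u * w) * v := by rw [← mul_assoc, h2, one_mul]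
      _ = q • (v * w * (u * v)) := by
        rw [h, mul_smul_comm, smul_mul_assoc]; simp only [mul_assoc]
      _ = q • (v * w) := by rw [h1, mul_one]
  have conj' : ∀ (u v w : HnZero n q), u * v = 1 → v * u = 1 → w * u = q • (u * w) →
      v * w = q • (w * v) := by
    intro u v w h1 h2 h
    calc v * w = v * (w * u) * v := by rw [mul_assoc, mul_assoc, h1, mul_one]
      _ = q • (v * u * w * v) := by
        rw [h, mul_smul_comm, smul_mul_assoc]; simp only [mul_assoc]
      _ = q • (w * v) := by rw [h2, one_mul]
  have aβ := conj b β a b1 b2 r.ba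
  have aγ := conj c γ a c1 c2 r.ca
  have βd := conj' b β d b1 b2 r.db
  have γd := conj' c γ d c1 c2 r.dc
  have q0 : q ≠ 0 := hq.out.ne_zero hn0
  have pa : (-(a * β)) ^ n = 0 := by
    have h : β * a = q⁻¹ • (a * β) := by rw [aβ, smul_smul, inv_mul_cancel₀ q0, one_smul]
    obtain ⟨s, hs⟩ := QBinomial.mul_pow_skew_exists h n
    rw [neg_pow, hs, r.an, zero_mul, smul_zero, mul_zero]
  have pd : (-(d * γ)) ^ n = 0 := by
    obtain ⟨s, hs⟩ := QBinomial.mul_pow_skew_exists γd n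
    rw [neg_pow, hs, r.dn, zero_mul, smul_zero, mul_zero]
  constructor
  · rw [← op_mul, ← op_mul, ← op_smul, neg_mul, mul_neg, smul_neg, aβ, mul_smul_comm,
      smul_mul_assoc, mul_assoc, aβ, mul_smul_comm]
  · rw [← op_mul, ← op_mul, ← op_smul, neg_mul, mul_neg, smul_neg, ← mul_assoc, βd,
      smul_mul_assoc, mul_assoc, mul_assoc, βγ]
  · rw [← op_mul, ← op_mul, ← op_smul, neg_mul, mul_neg, smul_neg, mul_assoc, βγ, ← mul_assoc,
      ← mul_assoc, aγ, smul_mul_assoc]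
  · rw [← op_mul, ← op_mul, ← op_smul, neg_mul, mul_neg, smul_neg, ← mul_assoc, γd,
      smul_mul_assoc]
  · rw [← op_mul, ← op_mul, βγ]
  · rw [← op_pow, pa, op_zero]
  · rw [← op_pow, βn, op_one]
  · rw [← op_pow, γn, op_one]
  · rw [← op_pow, pd, op_zero]
  · rw [← op_mul, ← op_mul, ← op_smul, neg_mul_neg, neg_mul_neg]
    congr 1
    calc a * β * (d * γ) = a * (β * d) * γ := by simp only [mul_assoc]
      _ = q • (a * d * (β * γ)) := by
        rw [βd, mul_smul_comm, smul_mul_assoc]; simp only [mul_assoc]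
      _ = d * a * (γ * β) := by rw [r.da, βγ, smul_mul_assoc]
      _ = d * (a * γ) * β := by simp only [mul_assoc]
      _ = q • (d * γ * (a * β)) := by
        rw [aγ, mul_smul_comm, smul_mul_assoc]; simp only [mul_assoc]

variable (n q) in
/-- The antipode. -/
def antipodeMap : HnZero n q →ₗ[K] HnZero n q :=
  (opLinearEquiv K).symm.toLinearMap ∘ₗ (lift (relations_antipode n q)).toLinearMap

theorem antipodeMap_mul (x y : HnZero n q) :
    antipodeMap n q (x * y) = antipodeMap n q y * antipodeMap n q x := by
  simp [antipodeMap]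

theorem antipodeMap_one : antipodeMap n q 1 = 1 := by simp [antipodeMap]

theorem antipodeMap_gen (g : Gen) : antipodeMap n q (gen n q g) =
    genMap (-(gen n q .a * gen n q .b ^ (n - 1))) (gen n q .b ^ (n - 1)) (gen n q .c ^ (n - 1))
      (-(gen n q .d * gen n q .c ^ (n - 1))) g := by
  cases g <;> simp [antipodeMap, genMap]

variable (n q) in
/-- The map `x ⊗ y ↦ S(x) y`. -/
def antiL : HnZero n q ⊗[K] HnZero n q →ₗ[K] HnZero n q :=
  LinearMap.mul' K _ ∘ₗ (antipodeMap n q).rTensor _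

variable (n q) in
/-- The map `x ⊗ y ↦ x S(y)`. -/
def antiR : HnZero n q ⊗[K] HnZero n q →ₗ[K] HnZero n q :=
  LinearMap.mul' K _ ∘ₗ (antipodeMap n q).lTensor _

theorem antiL_tmul (x y : HnZero n q) : antiL n q (x ⊗ₜ y) = antipodeMap n q x * y := rfl

theorem antiR_tmul (x y : HnZero n q) : antiR n q (x ⊗ₜ y) = x * antipodeMap n q y := rfl

theorem antiL_mul_tmul (s : HnZero n q ⊗[K] HnZero n q) (x y : HnZero n q) :
    antiL n q (s * x ⊗ₜ y) = antipodeMap n q x * antiL n q s * y := by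
  induction s with
  | zero => simp
  | add s s' hs hs' => simp only [add_mul, mul_add, map_add, hs, hs']
  | tmul g h =>
    simp only [Algebra.TensorProduct.tmul_mul_tmul, antiL_tmul, antipodeMap_mul, mul_assoc]

theorem antiR_tmul_mul (s : HnZero n q ⊗[K] HnZero n q) (x y : HnZero n q) :
    antiR n q (x ⊗ₜ y * s) = x * antiR n q s * antipodeMap n q y := by
  induction s with
  | zero => simp
  | add s s' hs hs' => simp only [add_mul, mul_add, map_add, hs, hs']
  | tmul g h =>
    simp only [Algebra.TensorProduct.tmul_mul_tmul, antiR_tmul, antipodeMap_mul, mul_assoc]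

theorem antiL_mul {s : HnZero n q ⊗[K] HnZero n q} {k : K}
    (hs : antiL n q s = algebraMap K _ k) (t : HnZero n q ⊗[K] HnZero n q) :
    antiL n q (s * t) = k • antiL n q t := by
  induction t with
  | zero => simp
  | add t t' ht ht' => simp only [mul_add, map_add, ht, ht', smul_add]
  | tmul x y =>
    rw [antiL_mul_tmul, hs, antiL_tmul, ← Algebra.commutes, mul_assoc, Algebra.smul_def]

theorem antiR_mul {t : HnZero n q ⊗[K] HnZero n q} {k : K}
    (ht : antiR n q t = algebraMap K _ k) (s : HnZero n q ⊗[K] HnZero n q) :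
    antiR n q (s * t) = k • antiR n q s := by
  induction s with
  | zero => simp
  | add s s' hs hs' => simp only [add_mul, map_add, hs, hs', smul_add]
  | tmul x y =>
    rw [antiR_tmul_mul, ht, antiR_tmul, ← Algebra.commutes, mul_assoc, Algebra.smul_def]

theorem antiL_comul (x : HnZero n q) :
    antiL n q (Coalgebra.comul (R := K) x) = algebraMap K _ (Coalgebra.counit (R := K) x) := by
  let B : Subalgebra K (HnZero n q) :=
    { carrier := {x | antiL n q (Coalgebra.comul (R := K) x) =
        algebraMap K _ (Coalgebra.counit (R := K) x)}
      mul_mem' := fun {x y} hx hy => by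
        rw [Set.mem_ofPred_eq] at hx hy ⊢
        rw [Bialgebra.comul_mul, Bialgebra.counit_mul, antiL_mul hx, hy, map_mul, Algebra.smul_def]
      add_mem' := fun {x y} hx hy => by
        rw [Set.mem_ofPred_eq] at hx hy ⊢
        rw [map_add, map_add, map_add, map_add, hx, hy]
      algebraMap_mem' := fun k => by
        rw [Set.mem_ofPred_eq, Bialgebra.comul_algebraMap, Bialgebra.counit_algebraMap,
          Algebra.algebraMap_eq_smul_one, map_smul, Algebra.TensorProduct.one_def, antiL_tmul,
          antipodeMap_one, mul_one, Algebra.algebraMap_eq_smul_one] }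
  have hB : B = ⊤ := eq_top_of_gen_mem B fun g => by
    have r := relations n q
    have hn0 : n ≠ 0 := ne_zero_of_fact
    change antiL n q (Coalgebra.comul (R := K) (gen n q g)) =
      algebraMap K _ (Coalgebra.counit (R := K) (gen n q g))
    rw [comul_gen, counit_gen]
    cases g
    · simp only [genMap, map_add, antiL_tmul, antipodeMap_gen, antipodeMap_one, neg_mul, mul_assoc,
        pow_sub_one_mul hn0, r.bn, mul_one, one_mul, map_zero, neg_add_cancel]
    · simp only [genMap, antiL_tmul, antipodeMap_gen, pow_sub_one_mul hn0, r.bn, map_one]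
    · simp only [genMap, antiL_tmul, antipodeMap_gen, pow_sub_one_mul hn0, r.cn, map_one]
    · simp only [genMap, map_add, antiL_tmul, antipodeMap_gen, antipodeMap_one, neg_mul, mul_assoc,
        pow_sub_one_mul hn0, r.cn, mul_one, one_mul, map_zero, neg_add_cancel]
  exact (hB ▸ Algebra.mem_top : x ∈ B)

theorem antiR_comul (x : HnZero n q) :
    antiR n q (Coalgebra.comul (R := K) x) = algebraMap K _ (Coalgebra.counit (R := K) x) := by
  let B : Subalgebra K (HnZero n q) :=
    { carrier := {x | antiR n q (Coalgebra.comul (R := K) x) =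
        algebraMap K _ (Coalgebra.counit (R := K) x)}
      mul_mem' := fun {x y} hx hy => by
        rw [Set.mem_ofPred_eq] at hx hy ⊢
        rw [Bialgebra.comul_mul, Bialgebra.counit_mul, antiR_mul hy, hx, mul_comm, map_mul,
          Algebra.smul_def]
      add_mem' := fun {x y} hx hy => by
        rw [Set.mem_ofPred_eq] at hx hy ⊢
        rw [map_add, map_add, map_add, map_add, hx, hy]
      algebraMap_mem' := fun k => by
        rw [Set.mem_ofPred_eq, Bialgebra.comul_algebraMap, Bialgebra.counit_algebraMap,
          Algebra.algebraMap_eq_smul_one, map_smul, Algebra.TensorProduct.one_def, antiR_tmul,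
          antipodeMap_one, mul_one, Algebra.algebraMap_eq_smul_one] }
  have hB : B = ⊤ := eq_top_of_gen_mem B fun g => by
    have r := relations n q
    have hn0 : n ≠ 0 := ne_zero_of_fact
    change antiR n q (Coalgebra.comul (R := K) (gen n q g)) =
      algebraMap K _ (Coalgebra.counit (R := K) (gen n q g))
    rw [comul_gen, counit_gen]
    cases g
    · simp only [genMap, map_add, antiR_tmul, antipodeMap_gen, one_mul, map_zero, add_neg_cancel]
    · simp only [genMap, antiR_tmul, antipodeMap_gen, mul_pow_sub_one hn0, r.bn, map_one]
    · simp only [genMap, antiR_tmul, antipodeMap_gen, mul_pow_sub_one hn0, r.cn, map_one]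
    · simp only [genMap, map_add, antiR_tmul, antipodeMap_gen, one_mul, map_zero, add_neg_cancel]
  exact (hB ▸ Algebra.mem_top : x ∈ B)

/-- `H_n(0,q)` is a Hopf algebra. -/
instance instHopfAlgebra : HopfAlgebra K (HnZero n q) where
  antipode := antipodeMap n q
  mul_antipode_rTensor_comul := LinearMap.ext antiL_comul
  mul_antipode_lTensor_comul := LinearMap.ext antiR_comul

end Antipode

end

end HnZero

/-! ## Finite-dimensional modules over a bialgebra, and their tensor products -/

/-- A finite-dimensional left module over a `K`-algebra `H`. -/
structure FDModule (K H : Type u) [Field K] [Ring H] [Algebra K H] where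
  carrier : Type u
  [addCommGroup : AddCommGroup carrier]
  [moduleK : Module K carrier]
  [moduleH : Module H carrier]
  [isScalarTower : IsScalarTower K H carrier]
  [finite : Module.Finite K carrier]

namespace FDModule

noncomputable section

attribute [instance] addCommGroup moduleK moduleH isScalarTower finite

section Algebra

variable {K H : Type u} [Field K] [Ring H] [Algebra K H]

instance : CoeSort (FDModule K H) (Type u) := ⟨carrier⟩

/-- The direct sum of two modules. -/
def directSum (M N : FDModule K H) : FDModule K H := ⟨M × N⟩

/-- The underlying space of the one-dimensional module given by a character. -/
def CharSpace (_χ : H →ₐ[K] K) : Type u := K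

instance (χ : H →ₐ[K] K) : AddCommGroup (CharSpace χ) := inferInstanceAs (AddCommGroup K)

instance (χ : H →ₐ[K] K) : Module K (CharSpace χ) := inferInstanceAs (Module K K)

instance (χ : H →ₐ[K] K) : Module.Finite K (CharSpace χ) := inferInstanceAs (Module.Finite K K)

instance (χ : H →ₐ[K] K) : Module H (CharSpace χ) := Module.compHom K χ.toRingHom

theorem char_smul_def (χ : H →ₐ[K] K) (h : H) (x : CharSpace χ) :
    h • x = (χ h • x : CharSpace χ) := rfl

instance (χ : H →ₐ[K] K) : IsScalarTower K H (CharSpace χ) :=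
  ⟨fun k h x => by rw [char_smul_def, char_smul_def, map_smul, smul_assoc]⟩

/-- The one-dimensional module on which `h` acts as the scalar `χ h`. -/
def char (χ : H →ₐ[K] K) : FDModule K H := ⟨CharSpace χ⟩

/-- `P` is a projective cover of `M`: it is projective and there is an epimorphism `P → M` with
superfluous kernel. -/
def IsProjectiveCover (P M : FDModule K H) : Prop :=
  Module.Projective H P ∧ ∃ f : P →ₗ[H] M, Function.Surjective f ∧
    ∀ N : Submodule H P, N ⊔ LinearMap.ker f = ⊤ → N = ⊤

variable (K H) in
/-- Isomorphism of modules. -/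
instance isoSetoid : Setoid (FDModule K H) where
  r M N := Nonempty (M ≃ₗ[H] N)
  iseqv := ⟨fun _ => ⟨.refl _ _⟩, fun ⟨e⟩ => ⟨e.symm⟩, fun ⟨e⟩ ⟨f⟩ => ⟨e.trans f⟩⟩

end Algebra

section Actions

variable {K H : Type u} [Field K] [Ring H] {U V W : Type u} [AddCommGroup U] [Module K U]
  [AddCommGroup V] [Module K V] [AddCommGroup W] [Module K W]

/-- The action of `H ⊗ H` on `V ⊗ W`, given actions of `H` on `V` and `W`. -/
def act₂ [Algebra K H] (ρ : H →ₐ[K] Module.End K V) (σ : H →ₐ[K] Module.End K W) :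
    H ⊗[K] H →ₐ[K] Module.End K (V ⊗[K] W) :=
  (Module.endTensorEndAlgHom (R := K) (S := K) (A := K)).comp (Algebra.TensorProduct.map ρ σ)

theorem act₂_tmul [Algebra K H] (ρ : H →ₐ[K] Module.End K V) (σ : H →ₐ[K] Module.End K W)
    (g h : H) (x : V) (y : W) : act₂ ρ σ (g ⊗ₜ h) (x ⊗ₜ y) = ρ g x ⊗ₜ σ h y := rfl

/-- The action of `H` on `V ⊗ W` through the comultiplication. -/
def tensorRep [Bialgebra K H] (ρ : H →ₐ[K] Module.End K V) (σ : H →ₐ[K] Module.End K W) :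
    H →ₐ[K] Module.End K (V ⊗[K] W) :=
  (act₂ ρ σ).comp (Bialgebra.comulAlgHom K H)

theorem tensorRep_apply [Bialgebra K H] (ρ : H →ₐ[K] Module.End K V)
    (σ : H →ₐ[K] Module.End K W) (h : H) :
    tensorRep ρ σ h = act₂ ρ σ (Coalgebra.comul (R := K) h) := rfl

theorem act₂_congr [Algebra K H] {V' W' : Type u} [AddCommGroup V'] [Module K V']
    [AddCommGroup W'] [Module K W'] {ρ : H →ₐ[K] Module.End K V} {σ : H →ₐ[K] Module.End K W}
    {ρ' : H →ₐ[K] Module.End K V'} {σ' : H →ₐ[K] Module.End K W'} (e : V ≃ₗ[K] V')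
    (f : W ≃ₗ[K] W') (he : ∀ h x, e (ρ h x) = ρ' h (e x)) (hf : ∀ h x, f (σ h x) = σ' h (f x))
    (s : H ⊗[K] H) (t : V ⊗[K] W) :
    TensorProduct.congr e f (act₂ ρ σ s t) = act₂ ρ' σ' s (TensorProduct.congr e f t) := by
  induction s with
  | zero => simp
  | add s s' hs hs' => simp only [map_add, LinearMap.add_apply, hs, hs']
  | tmul g h =>
    induction t with
    | zero => simp
    | add t t' ht ht' => simp only [map_add, ht, ht']
    | tmul x y => simp only [act₂_tmul, TensorProduct.congr_tmul, he, hf]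

/-- The action of `H ⊗ (H ⊗ H)` on `U ⊗ (V ⊗ W)`. -/
def act₃ [Algebra K H] (τ : H →ₐ[K] Module.End K U) (ρ : H →ₐ[K] Module.End K V)
    (σ : H →ₐ[K] Module.End K W) : H ⊗[K] (H ⊗[K] H) →ₐ[K] Module.End K (U ⊗[K] (V ⊗[K] W)) :=
  (Module.endTensorEndAlgHom (R := K) (S := K) (A := K)).comp
    (Algebra.TensorProduct.map τ (act₂ ρ σ))

theorem assoc_aux₁ [Algebra K H] (τ : H →ₐ[K] Module.End K U) (ρ : H →ₐ[K] Module.End K V)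
    (σ : H →ₐ[K] Module.End K W) (h : H) (s : H ⊗[K] H) (x : U ⊗[K] V) (z : W) :
    TensorProduct.assoc K U V W (act₂ τ ρ s x ⊗ₜ σ h z) =
      act₃ τ ρ σ (TensorProduct.assoc K H H H (s ⊗ₜ h))
        (TensorProduct.assoc K U V W (x ⊗ₜ z)) := by
  induction s with
  | zero => simp
  | add s s' hs hs' => simp only [map_add, LinearMap.add_apply, TensorProduct.add_tmul, hs, hs']
  | tmul g g' =>
    induction x with
    | zero => simp
    | add t t' ht ht' => simp only [map_add, TensorProduct.add_tmul, ht, ht']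
    | tmul x y => rfl

theorem assoc_aux₂ [Bialgebra K H] (τ : H →ₐ[K] Module.End K U) (ρ : H →ₐ[K] Module.End K V)
    (σ : H →ₐ[K] Module.End K W) (s : H ⊗[K] H) (t : (U ⊗[K] V) ⊗[K] W) :
    TensorProduct.assoc K U V W (act₂ (tensorRep τ ρ) σ s t) =
      act₃ τ ρ σ (TensorProduct.assoc K H H H
        ((Coalgebra.comul (R := K) (A := H)).rTensor H s)) (TensorProduct.assoc K U V W t) := by
  induction s with
  | zero => simp
  | add s s' hs hs' => simp only [map_add, LinearMap.add_apply, hs, hs']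
  | tmul g h =>
    induction t with
    | zero => simp
    | add t t' ht ht' => simp only [map_add, ht, ht']
    | tmul x z => exact assoc_aux₁ τ ρ σ h (Coalgebra.comul g) x z

theorem assoc_aux₃ [Bialgebra K H] (τ : H →ₐ[K] Module.End K U) (ρ : H →ₐ[K] Module.End K V)
    (σ : H →ₐ[K] Module.End K W) (s : H ⊗[K] H) (t : U ⊗[K] (V ⊗[K] W)) :
    act₂ τ (tensorRep ρ σ) s t =
      act₃ τ ρ σ ((Coalgebra.comul (R := K) (A := H)).lTensor H s) t := by
  induction s with
  | zero => simp
  | add s s' hs hs' => simp only [map_add, LinearMap.add_apply, hs, hs']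
  | tmul g h =>
    induction t with
    | zero => simp
    | add t t' ht ht' => simp only [map_add, ht, ht']
    | tmul x z => rfl

theorem tensorRep_assoc [Bialgebra K H] (τ : H →ₐ[K] Module.End K U) (ρ : H →ₐ[K] Module.End K V)
    (σ : H →ₐ[K] Module.End K W) (h : H) (t : (U ⊗[K] V) ⊗[K] W) :
    TensorProduct.assoc K U V W (tensorRep (tensorRep τ ρ) σ h t) =
      tensorRep τ (tensorRep ρ σ) h (TensorProduct.assoc K U V W t) := by
  rw [tensorRep_apply, assoc_aux₂, Coalgebra.coassoc_apply, tensorRep_apply τ, assoc_aux₃]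

variable (K H) in
/-- The action of `H` on `K` through the counit. -/
def counitRep [Bialgebra K H] : H →ₐ[K] Module.End K K :=
  (Algebra.lsmul K K K).comp (Bialgebra.counitAlgHom K H)

theorem lid_aux [Bialgebra K H] (ρ : H →ₐ[K] Module.End K V) (s : H ⊗[K] H) (t : K ⊗[K] V) :
    TensorProduct.lid K V (act₂ (counitRep K H) ρ s t) =
      ρ (TensorProduct.lid K H ((Coalgebra.counit (R := K) (A := H)).rTensor H s))
        (TensorProduct.lid K V t) := by
  induction s with
  | zero => simp
  | add s s' hs hs' => simp only [map_add, LinearMap.add_apply, hs, hs']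
  | tmul g h =>
    induction t with
    | zero => simp
    | add t t' ht ht' => simp only [map_add, ht, ht']
    | tmul x z => simp [act₂_tmul, counitRep, mul_smul, smul_comm x]

theorem tensorRep_lid [Bialgebra K H] (ρ : H →ₐ[K] Module.End K V) (h : H) (t : K ⊗[K] V) :
    TensorProduct.lid K V (tensorRep (counitRep K H) ρ h t) =
      ρ h (TensorProduct.lid K V t) := by
  rw [tensorRep_apply, lid_aux, Coalgebra.rTensor_counit_comul, TensorProduct.lid_tmul, one_smul]

theorem rid_aux [Bialgebra K H] (ρ : H →ₐ[K] Module.End K V) (s : H ⊗[K] H) (t : V ⊗[K] K) :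
    TensorProduct.rid K V (act₂ ρ (counitRep K H) s t) =
      ρ (TensorProduct.rid K H ((Coalgebra.counit (R := K) (A := H)).lTensor H s))
        (TensorProduct.rid K V t) := by
  induction s with
  | zero => simp
  | add s s' hs hs' => simp only [map_add, LinearMap.add_apply, hs, hs']
  | tmul h g =>
    induction t with
    | zero => simp
    | add t t' ht ht' => simp only [map_add, ht, ht']
    | tmul z x => simp [act₂_tmul, counitRep, mul_smul, smul_comm x]

theorem tensorRep_rid [Bialgebra K H] (ρ : H →ₐ[K] Module.End K V) (h : H) (t : V ⊗[K] K) :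
    TensorProduct.rid K V (tensorRep ρ (counitRep K H) h t) =
      ρ h (TensorProduct.rid K V t) := by
  rw [tensorRep_apply, rid_aux, Coalgebra.lTensor_counit_comul, TensorProduct.rid_tmul, one_smul]

theorem prodRight_aux [Algebra K H] (τ : H →ₐ[K] Module.End K U) (ρ : H →ₐ[K] Module.End K V)
    (σ : H →ₐ[K] Module.End K W) (θ : H →ₐ[K] Module.End K (V × W))
    (hθ : ∀ h x, θ h x = (ρ h x.1, σ h x.2)) (s : H ⊗[K] H) (t : U ⊗[K] (V × W)) :
    TensorProduct.prodRight K K U V W (act₂ τ θ s t) =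
      (act₂ τ ρ s (TensorProduct.prodRight K K U V W t).1,
        act₂ τ σ s (TensorProduct.prodRight K K U V W t).2) := by
  induction s with
  | zero => simp only [map_zero, LinearMap.zero_apply]; rfl
  | add s s' hs hs' => simp only [map_add, LinearMap.add_apply, hs, hs', Prod.mk_add_mk]
  | tmul g h =>
    induction t with
    | zero => simp only [map_zero, Prod.fst_zero, Prod.snd_zero]; rfl
    | add t t' ht ht' => simp only [map_add, ht, ht', Prod.fst_add, Prod.snd_add, Prod.mk_add_mk]
    | tmul x z => simp only [act₂_tmul, hθ, TensorProduct.prodRight_tmul]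

theorem prodLeft_aux [Algebra K H] (τ : H →ₐ[K] Module.End K U) (ρ : H →ₐ[K] Module.End K V)
    (σ : H →ₐ[K] Module.End K W) (θ : H →ₐ[K] Module.End K (V × W))
    (hθ : ∀ h x, θ h x = (ρ h x.1, σ h x.2)) (s : H ⊗[K] H) (t : (V × W) ⊗[K] U) :
    TensorProduct.prodLeft K K V W U (act₂ θ τ s t) =
      (act₂ ρ τ s (TensorProduct.prodLeft K K V W U t).1,
        act₂ σ τ s (TensorProduct.prodLeft K K V W U t).2) := by
  induction s with
  | zero => simp only [map_zero, LinearMap.zero_apply]; rfl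
  | add s s' hs hs' => simp only [map_add, LinearMap.add_apply, hs, hs', Prod.mk_add_mk]
  | tmul g h =>
    induction t with
    | zero => simp only [map_zero, Prod.fst_zero, Prod.snd_zero]; rfl
    | add t t' ht ht' => simp only [map_add, ht, ht', Prod.fst_add, Prod.snd_add, Prod.mk_add_mk]
    | tmul x z => rw [act₂_tmul, hθ]; rfl

end Actions

variable {K H : Type u} [Field K] [Ring H] [Bialgebra K H]

/-- The action of `H` on a module by `K`-linear endomorphisms. -/
def rep (M : FDModule K H) : H →ₐ[K] Module.End K M := Algebra.lsmul K K M

/-- The underlying space of the tensor product `M ⊗ N` over `K`. -/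
def TensorSpace (M N : FDModule K H) : Type u := M ⊗[K] N

instance (M N : FDModule K H) : AddCommGroup (TensorSpace M N) :=
  inferInstanceAs (AddCommGroup (M ⊗[K] N))

instance (M N : FDModule K H) : Module K (TensorSpace M N) :=
  inferInstanceAs (Module K (M ⊗[K] N))

instance (M N : FDModule K H) : Module.Finite K (TensorSpace M N) :=
  inferInstanceAs (Module.Finite K (M ⊗[K] N))

/-- `H` acts on `M ⊗ N` through the comultiplication. -/
instance (M N : FDModule K H) : Module H (TensorSpace M N) :=
  Module.compHom (M ⊗[K] N) (tensorRep M.rep N.rep).toRingHom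

theorem tensor_smul_def (M N : FDModule K H) (h : H) (t : TensorSpace M N) :
    h • t = tensorRep M.rep N.rep h t := rfl

instance (M N : FDModule K H) : IsScalarTower K H (TensorSpace M N) :=
  ⟨fun k h t => by rw [tensor_smul_def, tensor_smul_def, map_smul]; rfl⟩

/-- The tensor product of two modules. -/
def tensor (M N : FDModule K H) : FDModule K H := ⟨TensorSpace M N⟩

variable (K H) in
/-- The trivial module: `K` with `H` acting through the counit. -/
def trivial : FDModule K H := char (Bialgebra.counitAlgHom K H)

/-- A `K`-linear equivalence that respects the actions. -/
def mkIso {V W : Type u} [AddCommGroup V] [Module K V] [Module H V] [AddCommGroup W] [Module K W]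
    [Module H W] (e : V ≃ₗ[K] W) (h : ∀ (g : H) (x : V), e (g • x) = g • e x) : V ≃ₗ[H] W :=
  { e with map_smul' := h }

theorem tensor_congr {M M' N N' : FDModule K H} (e : M ≃ₗ[H] M') (f : N ≃ₗ[H] N') :
    Nonempty (tensor M N ≃ₗ[H] tensor M' N') :=
  ⟨mkIso (V := TensorSpace M N) (W := TensorSpace M' N')
    (TensorProduct.congr (e.restrictScalars K) (f.restrictScalars K) : M ⊗[K] N ≃ₗ[K] M' ⊗[K] N')
    fun _ t => act₂_congr (ρ := M.rep) (σ := N.rep) (ρ' := M'.rep) (σ' := N'.rep)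
      (e.restrictScalars K) (f.restrictScalars K) (fun h x => e.map_smul h x)
      (fun h x => f.map_smul h x) _ t⟩

theorem tensor_assoc (L M N : FDModule K H) :
    Nonempty (tensor (tensor L M) N ≃ₗ[H] tensor L (tensor M N)) :=
  ⟨mkIso (V := TensorSpace (tensor L M) N) (W := TensorSpace L (tensor M N))
    (TensorProduct.assoc K L M N : (L ⊗[K] M) ⊗[K] N ≃ₗ[K] L ⊗[K] (M ⊗[K] N))
    fun g t => tensorRep_assoc L.rep M.rep N.rep g t⟩

theorem trivial_tensor (M : FDModule K H) : Nonempty (tensor (trivial K H) M ≃ₗ[H] M) :=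
  ⟨mkIso (V := TensorSpace (trivial K H) M) (TensorProduct.lid K M : K ⊗[K] M ≃ₗ[K] M)
    fun g t => tensorRep_lid M.rep g t⟩

theorem tensor_trivial (M : FDModule K H) : Nonempty (tensor M (trivial K H) ≃ₗ[H] M) :=
  ⟨mkIso (V := TensorSpace M (trivial K H)) (TensorProduct.rid K M : M ⊗[K] K ≃ₗ[K] M)
    fun g t => tensorRep_rid M.rep g t⟩

theorem tensor_directSum (L M N : FDModule K H) :
    Nonempty (tensor L (directSum M N) ≃ₗ[H] directSum (tensor L M) (tensor L N)) :=
  ⟨mkIso (V := TensorSpace L (directSum M N)) (W := TensorSpace L M × TensorSpace L N)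
    (TensorProduct.prodRight K K L M N : L ⊗[K] (M × N) ≃ₗ[K] (L ⊗[K] M) × (L ⊗[K] N))
    fun _ t => prodRight_aux L.rep M.rep N.rep (directSum M N).rep (fun _ _ => rfl) _ t⟩

theorem directSum_tensor (L M N : FDModule K H) :
    Nonempty (tensor (directSum M N) L ≃ₗ[H] directSum (tensor M L) (tensor N L)) :=
  ⟨mkIso (V := TensorSpace (directSum M N) L) (W := TensorSpace M L × TensorSpace N L)
    (TensorProduct.prodLeft K K M N L : (M × N) ⊗[K] L ≃ₗ[K] (M ⊗[K] L) × (N ⊗[K] L))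
    fun _ t => prodLeft_aux L.rep M.rep N.rep (directSum M N).rep (fun _ _ => rfl) _ t⟩

end

end FDModule

/-! ## The Green ring and the projective class ring -/

/-- Isomorphism classes of finite-dimensional `H`-modules. -/
def IsoClass (K H : Type u) [Field K] [Ring H] [Algebra K H] : Type (u + 1) :=
  Quotient (FDModule.isoSetoid K H)

noncomputable section

namespace IsoClass

variable {K H : Type u} [Field K] [Ring H]

/-- The isomorphism class of a module. -/
def mk [Algebra K H] (M : FDModule K H) : IsoClass K H := Quotient.mk _ M

theorem sound [Algebra K H] {M N : FDModule K H} (h : Nonempty (M ≃ₗ[H] N)) : mk M = mk N :=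
  Quotient.sound h

/-- Isomorphism classes form a monoid under the tensor product. -/
instance [Bialgebra K H] : Monoid (IsoClass K H) where
  mul := Quotient.map₂ FDModule.tensor fun _ _ ⟨e⟩ _ _ ⟨f⟩ => FDModule.tensor_congr e f
  one := mk (FDModule.trivial K H)
  mul_assoc := by
    rintro ⟨L⟩ ⟨M⟩ ⟨N⟩
    exact sound (FDModule.tensor_assoc L M N)
  one_mul := by
    rintro ⟨M⟩
    exact sound (FDModule.trivial_tensor M)
  mul_one := by
    rintro ⟨M⟩
    exact sound (FDModule.tensor_trivial M)

theorem mk_mul_mk [Bialgebra K H] (M N : FDModule K H) : mk M * mk N = mk (M.tensor N) := rfl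

end IsoClass

namespace GreenRing

variable (K H : Type u) [Field K] [Ring H]

/-- The subgroup generated by the elements `[M ⊕ N] - [M] - [N]`. -/
def relSubgroup [Algebra K H] : AddSubgroup (FreeAbelianGroup (IsoClass K H)) :=
  AddSubgroup.closure {x | ∃ M N : FDModule K H, x = FreeAbelianGroup.of (IsoClass.mk (M.directSum N))
    - FreeAbelianGroup.of (IsoClass.mk M) - FreeAbelianGroup.of (IsoClass.mk N)}

variable {K H}

theorem mul_mem_left [Bialgebra K H] (x : FreeAbelianGroup (IsoClass K H))
    {y : FreeAbelianGroup (IsoClass K H)} (hy : y ∈ relSubgroup K H) : x * y ∈ relSubgroup K H := by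
  induction x using FreeAbelianGroup.induction_on with
  | zero => rw [zero_mul]; exact zero_mem _
  | neg x h => rw [neg_mul]; exact neg_mem h
  | add x x' h h' => rw [add_mul]; exact add_mem h h'
  | of x =>
    obtain ⟨L, rfl⟩ : ∃ L, x = IsoClass.mk L := ⟨x.out, (Quotient.out_eq x).symm⟩
    induction hy using AddSubgroup.closure_induction with
    | zero => rw [mul_zero]; exact zero_mem _
    | neg y _ h => rw [mul_neg]; exact neg_mem h
    | add y y' _ _ h h' => rw [mul_add]; exact add_mem h h'
    | mem y hy =>
      obtain ⟨M, N, rfl⟩ := hy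
      refine AddSubgroup.subset_closure ⟨L.tensor M, L.tensor N, ?_⟩
      rw [mul_sub, mul_sub, FreeAbelianGroup.of_mul_of, FreeAbelianGroup.of_mul_of,
        FreeAbelianGroup.of_mul_of, IsoClass.mk_mul_mk, IsoClass.mk_mul_mk, IsoClass.mk_mul_mk,
        IsoClass.sound (FDModule.tensor_directSum L M N)]

theorem mul_mem_right [Bialgebra K H] {x : FreeAbelianGroup (IsoClass K H)}
    (y : FreeAbelianGroup (IsoClass K H)) (hx : x ∈ relSubgroup K H) : x * y ∈ relSubgroup K H := by
  induction y using FreeAbelianGroup.induction_on with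
  | zero => rw [mul_zero]; exact zero_mem _
  | neg y h => rw [mul_neg]; exact neg_mem h
  | add y y' h h' => rw [mul_add]; exact add_mem h h'
  | of y =>
    obtain ⟨L, rfl⟩ : ∃ L, y = IsoClass.mk L := ⟨y.out, (Quotient.out_eq y).symm⟩
    induction hx using AddSubgroup.closure_induction with
    | zero => rw [zero_mul]; exact zero_mem _
    | neg y _ h => rw [neg_mul]; exact neg_mem h
    | add y y' _ _ h h' => rw [add_mul]; exact add_mem h h'
    | mem y hy =>
      obtain ⟨M, N, rfl⟩ := hy
      refine AddSubgroup.subset_closure ⟨M.tensor L, N.tensor L, ?_⟩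
      rw [sub_mul, sub_mul, FreeAbelianGroup.of_mul_of, FreeAbelianGroup.of_mul_of,
        FreeAbelianGroup.of_mul_of, IsoClass.mk_mul_mk, IsoClass.mk_mul_mk, IsoClass.mk_mul_mk,
        IsoClass.sound (FDModule.directSum_tensor L M N)]

variable (K H) in
/-- The subgroup `relSubgroup` is a two-sided ideal for the product `[M][N] = [M ⊗ N]`. -/
def relIdeal [Bialgebra K H] : TwoSidedIdeal (FreeAbelianGroup (IsoClass K H)) :=
  TwoSidedIdeal.mk' (relSubgroup K H) (zero_mem _) add_mem neg_mem (mul_mem_left _)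
    (mul_mem_right _)

end GreenRing

/-- The Green ring `r(H)`: the abelian group generated by the isomorphism classes of
finite-dimensional `H`-modules modulo `[M ⊕ N] = [M] + [N]`, with product `[M][N] = [M ⊗ N]`. -/
abbrev GreenRing (K H : Type u) [Field K] [Ring H] [Bialgebra K H] : Type (u + 1) :=
  (GreenRing.relIdeal K H).ringCon.Quotient

/-- The class `[M]` in the Green ring. -/
def GreenRing.cls {K H : Type u} [Field K] [Ring H] [Bialgebra K H] (M : FDModule K H) :
    GreenRing K H :=
  (GreenRing.relIdeal K H).ringCon.mk' (FreeAbelianGroup.of (IsoClass.mk M))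

/-- The projective class ring `r_p(H)`: the subring of the Green ring generated by the classes of
the projective modules and of the simple modules. -/
def projectiveClassRing (K H : Type u) [Field K] [Ring H] [Bialgebra K H] :
    Subring (GreenRing K H) :=
  Subring.closure {x | ∃ M : FDModule K H,
    (Module.Projective H M ∨ IsSimpleModule H M) ∧ x = GreenRing.cls M}

/-! ## The simple modules `S_{i,j}` and the polynomial presentation -/

theorem HnZero.relations_simple {K : Type u} [Field K] (n : ℕ) (q : K) [hn : Fact (2 < n)]
    [hq : Fact (IsPrimitiveRoot q n)] (i j : ZMod n) :
    HnZero.Relations n q (0 : K) (q ^ i.val) (q ^ j.val) 0 := by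
  refine HnZero.relations_scalar HnZero.ne_zero_of_fact ?_ ?_ <;>
    rw [pow_right_comm, hq.out.pow_eq_one, one_pow]

/-- The one-dimensional module `S_{i,j}`: `a` and `d` act as `0`, `b` as `q ^ i`, `c` as
`q ^ j`. -/
def HnZero.simple {K : Type u} [Field K] (n : ℕ) (q : K) [Fact (2 < n)]
    [Fact (IsPrimitiveRoot q n)] (i j : ZMod n) : FDModule K (HnZero n q) :=
  FDModule.char (HnZero.lift (HnZero.relations_simple n q i j))

open MvPolynomial in
/-- The ideal `(xⁿ - 1, yⁿ - 1, z² - n ∑ xⁱ z)` of `ℤ[x,y,z]`, with `x, y, z` the variables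
`0, 1, 2`. -/
def classIdeal (n : ℕ) : Ideal (MvPolynomial (Fin 3) ℤ) :=
  Ideal.span {X 0 ^ n - 1, X 1 ^ n - 1,
    X 2 ^ 2 - (n : MvPolynomial (Fin 3) ℤ) * ∑ i ∈ Finset.range n, X 0 ^ i * X 2}

end

/-! The nilpotent elements `a` and `d` commute up to a scalar, so each of them kills every simple
module, and the simple modules are the one-dimensional modules `oneDim i j` on which `b` acts as
`q ^ i` and `c` as `q ^ j`. The module `induced i j` induced from this weight of `⟨b, c⟩` has a
basis `aᵏ dˡ u` of weight vectors and represents the functor of weight vectors of weight `(i, j)`.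
Hence it is projective; it is the projective cover of `oneDim i j`.

If `u` generates `induced i j` and the `e p` form a basis of `M` of weight vectors, then the vectors
`u ⊗ e p` generate `induced i j ⊗ M`, and comparing dimensions gives
`induced i j ⊗ M ≅ ⨁ p, induced (i + k p) (j + l p)`, where `(k p, l p)` is the weight of `e p`. The
relations between the classes of the generators follow.

The rank of the action of an element of `H` is additive on direct sums, so it factors through the
Green ring. The ranks of the elements `aⁿ⁻¹ dⁿ⁻¹ e` and `e`, for `e` the projector onto a weight
space, show that the classes of the modules `oneDim i j` and `induced i j` are linearly independent;
these classes are the images of the monomials spanning the polynomial presentation. -/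

/-! ## Finite-dimensional modules and the Green ring -/

theorem finrank_submodule_prod {K V W : Type*} [DivisionRing K] [AddCommGroup V] [Module K V]
    [AddCommGroup W] [Module K W] [Module.Finite K V] [Module.Finite K W] (p : Submodule K V)
    (r : Submodule K W) :
    Module.finrank K (p.prod r) = Module.finrank K p + Module.finrank K r := by
  have hrange : p.prod r = LinearMap.range (p.subtype.prodMap r.subtype) := by
    rw [LinearMap.range_prodMap, Submodule.range_subtype, Submodule.range_subtype]
  rw [hrange, LinearMap.finrank_range_of_inj
    (Function.Injective.prodMap p.subtype_injective r.subtype_injective), Module.finrank_prod]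

namespace FDModule

noncomputable section

variable {K H : Type u} [Field K] [Ring H] [Algebra K H]

/-- The direct sum of a finite family of modules. -/
def pi {ι : Type} [Finite ι] (M : ι → FDModule K H) : FDModule K H := ⟨∀ i, M i⟩

/-- A submodule of a finite-dimensional module, as a finite-dimensional module. -/
def ofSubmodule {M : FDModule K H} (N : Submodule H M) : FDModule K H :=
  { carrier := N
    finite := inferInstanceAs (Module.Finite K (N.restrictScalars K)) }

/-- The space `V` of a representation `ρ`, on which `H` acts through `ρ`. -/
def RepSpace {V : Type u} [AddCommGroup V] [Module K V] (_ρ : H →ₐ[K] Module.End K V) : Type u := V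

section RepSpace

variable {V : Type u} [AddCommGroup V] [Module K V] (ρ : H →ₐ[K] Module.End K V)

instance : AddCommGroup (RepSpace ρ) := inferInstanceAs (AddCommGroup V)

instance : Module K (RepSpace ρ) := inferInstanceAs (Module K V)

instance [Module.Finite K V] : Module.Finite K (RepSpace ρ) := inferInstanceAs (Module.Finite K V)

instance : Module H (RepSpace ρ) := Module.compHom V ρ.toRingHom

theorem rep_smul_def (h : H) (x : RepSpace ρ) : h • x = (ρ h (x : V) : V) := rfl

instance : IsScalarTower K H (RepSpace ρ) :=
  ⟨fun k h x => by rw [rep_smul_def, rep_smul_def, map_smul]; rfl⟩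

/-- The module given by a representation on a finite-dimensional space. -/
def ofRep [Module.Finite K V] : FDModule K H := ⟨RepSpace ρ⟩

end RepSpace

/-- The rank of the action of `h` on a module. -/
def rankOf (h : H) (M : FDModule K H) : ℕ :=
  Module.finrank K (LinearMap.range (Algebra.lsmul K K M h))

theorem rankOf_congr (h : H) {M N : FDModule K H} (e : M ≃ₗ[H] N) : rankOf h M = rankOf h N := by
  let f : M ≃ₗ[K] N := e.restrictScalars K
  have hcomm : Algebra.lsmul K K N h ∘ₗ f.toLinearMap = f.toLinearMap ∘ₗ Algebra.lsmul K K M h :=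
    LinearMap.ext fun x => (map_smul e h x).symm
  calc rankOf h M
      = Module.finrank K (LinearMap.range (f.toLinearMap ∘ₗ Algebra.lsmul K K M h)) := by
        rw [LinearMap.range_comp, LinearEquiv.finrank_map_eq, rankOf]
    _ = rankOf h N := by
        rw [← hcomm, LinearMap.range_comp_of_range_eq_top _ f.range, rankOf]

theorem rankOf_directSum (h : H) (M N : FDModule K H) :
    rankOf h (M.directSum N) = rankOf h M + rankOf h N := by
  let f := Algebra.lsmul K K M h
  let g := Algebra.lsmul K K N h
  calc rankOf h (M.directSum N)
      = Module.finrank K ((LinearMap.range f).prod (LinearMap.range g)) := by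
        rw [← LinearMap.range_prodMap]; rfl
    _ = rankOf h M + rankOf h N := finrank_submodule_prod _ _

namespace IsProjectiveCover

theorem surjective_of_comp {P M L : Type*} [AddCommGroup P] [Module H P] [AddCommGroup M]
    [Module H M] [AddCommGroup L] [Module H L] {f : P →ₗ[H] M}
    (hf : ∀ N : Submodule H P, N ⊔ LinearMap.ker f = ⊤ → N = ⊤) (g : L →ₗ[H] P)
    (hfg : Function.Surjective (f ∘ₗ g)) : Function.Surjective g := by
  refine LinearMap.range_eq_top.mp (hf _ (eq_top_iff.mpr fun x _ => ?_))
  obtain ⟨y, hy⟩ := hfg (f x)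
  rw [← add_sub_cancel (g y) x]
  refine Submodule.add_mem_sup ⟨y, rfl⟩ ?_
  rw [LinearMap.mem_ker, map_sub, ← hy, LinearMap.comp_apply, sub_self]

theorem nonempty_equiv {P P' M : FDModule K H} (h : P.IsProjectiveCover M)
    (h' : P'.IsProjectiveCover M) : Nonempty (P ≃ₗ[H] P') := by
  obtain ⟨_, f, hf, hfs⟩ := h
  obtain ⟨_, f', hf', hfs'⟩ := h'
  obtain ⟨g, hg⟩ := Module.projective_lifting_property f f' hf
  have hg_surj := surjective_of_comp hfs g (by rwa [hg])
  obtain ⟨s, hs⟩ := Module.projective_lifting_property g LinearMap.id hg_surj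
  have hs_surj := surjective_of_comp hfs' s (by
    rwa [← hg, LinearMap.comp_assoc, hs, LinearMap.comp_id])
  exact ⟨LinearEquiv.ofBijective s
    ⟨Function.LeftInverse.injective fun x => LinearMap.congr_fun hs x, hs_surj⟩⟩

end IsProjectiveCover

theorem nonempty_equiv_directSum_ker {M P : FDModule K H} [Module.Projective H P] (g : M →ₗ[H] P)
    (hg : Function.Surjective g) :
    Nonempty (M ≃ₗ[H] (ofSubmodule (LinearMap.ker g)).directSum P) := by
  obtain ⟨s, hs⟩ := Module.projective_lifting_property g LinearMap.id hg
  have hex : Function.Exact (LinearMap.ker g).subtype g := LinearMap.exact_subtype_ker_map g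
  exact ⟨(hex.splitSurjectiveEquiv (Submodule.injective_subtype _) ⟨s, hs⟩).1⟩

end

end FDModule

namespace GreenRing

noncomputable section

variable {K H : Type u} [Field K] [Ring H] [Bialgebra K H]

theorem cls_congr {M N : FDModule K H} (e : M ≃ₗ[H] N) : cls M = cls N := by
  rw [cls, cls, IsoClass.sound ⟨e⟩]

theorem cls_mul (M N : FDModule K H) : cls M * cls N = cls (M.tensor N) := by
  rw [cls, cls, ← map_mul, FreeAbelianGroup.of_mul_of, IsoClass.mk_mul_mk, cls]

theorem cls_trivial : cls (FDModule.trivial K H) = 1 := rfl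

theorem ringCon_iff_sub_mem (x y : FreeAbelianGroup (IsoClass K H)) :
    (relIdeal K H).ringCon x y ↔ x - y ∈ relSubgroup K H := by
  rw [TwoSidedIdeal.rel_iff]
  exact TwoSidedIdeal.mem_mk' _ _ _ _ _ _ _

theorem cls_directSum (M N : FDModule K H) : cls (M.directSum N) = cls M + cls N := by
  rw [cls, cls, cls, ← map_add]
  refine (RingCon.eq _).mpr ((ringCon_iff_sub_mem _ _).mpr ?_)
  rw [← sub_sub]
  exact AddSubgroup.subset_closure ⟨M, N, rfl⟩

/-- The universal property of the additive group of the Green ring: an invariant of isomorphism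
classes which is additive on direct sums extends to the Green ring. -/
def lift {A : Type*} [AddCommGroup A] (f : IsoClass K H → A)
    (hf : ∀ M N : FDModule K H,
      f (IsoClass.mk (M.directSum N)) = f (IsoClass.mk M) + f (IsoClass.mk N)) :
    GreenRing K H →+ A :=
  (relIdeal K H).ringCon.toAddCon.lift (FreeAbelianGroup.lift f) fun x y hxy => by
    have hle : relSubgroup K H ≤ (FreeAbelianGroup.lift f).ker := by
      rw [relSubgroup, AddSubgroup.closure_le]
      rintro _ ⟨M, N, rfl⟩
      simp only [SetLike.mem_coe, AddMonoidHom.mem_ker, map_sub, FreeAbelianGroup.lift_apply_of]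
      rw [hf, sub_sub, sub_self]
    have hker := hle ((ringCon_iff_sub_mem x y).mp hxy)
    rw [AddMonoidHom.mem_ker, map_sub, sub_eq_zero] at hker
    exact hker

theorem lift_cls {A : Type*} [AddCommGroup A] {f : IsoClass K H → A}
    (hf : ∀ M N : FDModule K H,
      f (IsoClass.mk (M.directSum N)) = f (IsoClass.mk M) + f (IsoClass.mk N))
    (M : FDModule K H) : lift f hf (cls M) = f (IsoClass.mk M) :=
  FreeAbelianGroup.lift_apply_of _ _

/-- The additive homomorphism sending `[M]` to the rank of the action of `h` on `M`. -/
def rankHom (h : H) : GreenRing K H →+ ℤ :=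
  lift (Quotient.lift (fun M : FDModule K H => (M.rankOf h : ℤ)) fun _ _ ⟨e⟩ => by
      rw [FDModule.rankOf_congr h e])
    fun M N => (congrArg Nat.cast (FDModule.rankOf_directSum h M N)).trans (Nat.cast_add _ _)

theorem rankHom_cls (h : H) (M : FDModule K H) : rankHom h (cls M) = M.rankOf h :=
  lift_cls _ M

theorem cls_of_subsingleton (M : FDModule K H) [Subsingleton M] : cls M = 0 := by
  have : Subsingleton (M.directSum M) := inferInstanceAs (Subsingleton (M × M))
  have h := cls_congr (0 : M.directSum M ≃ₗ[H] M)
  rw [cls_directSum] at h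
  exact left_eq_add.mp h.symm

theorem cls_pi {ι : Type} [Fintype ι] (M : ι → FDModule K H) :
    cls (FDModule.pi M) = ∑ i, cls (M i) := by
  revert M
  refine Fintype.induction_empty_option
    (P := fun ι _ => ∀ M : ι → FDModule K H, cls (FDModule.pi M) = ∑ i, cls (M i)) ?_ ?_ ?_ ι
  · intro α β _ e ih M
    let _ := Fintype.ofEquiv β e.symm
    rw [← e.sum_comp, ← ih]
    exact cls_congr (LinearEquiv.piCongrLeft H (fun i => (M i : Type u)) e).symm
  · intro M
    have : Subsingleton (FDModule.pi M) := inferInstanceAs (Subsingleton (∀ i, M i))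
    rw [cls_of_subsingleton, Finset.univ_eq_empty, Finset.sum_empty]
  · intro α _ ih M
    rw [Fintype.sum_option, ← ih, ← cls_directSum]
    exact cls_congr (M := FDModule.pi M)
      (N := (M none).directSum (FDModule.pi fun i => M (some i)))
      { Equiv.piOptionEquivProd (β := fun i => (M i : Type u)) with
        map_add' := fun _ _ => rfl
        map_smul' := fun _ _ => rfl }

end

end GreenRing

/-! ## Weights -/

section EigenProj

section

variable {K : Type*} [Field K] {n : ℕ} {q : K}

theorem zpow_pow_eq_one (hq : IsPrimitiveRoot q n) (i : ℤ) : (q ^ i) ^ n = 1 := by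
  rw [← zpow_natCast, zpow_comm, zpow_natCast, hq.pow_eq_one, one_zpow]

theorem geom_sum_zpow (hq : IsPrimitiveRoot q n) (k : ℤ) :
    ∑ m ∈ Finset.range n, (q ^ k) ^ m = if (n : ℤ) ∣ k then (n : K) else 0 := by
  split_ifs with hk
  · simp [(hq.zpow_eq_one_iff_dvd k).mpr hk]
  · have hne : q ^ k - 1 ≠ 0 := sub_ne_zero.mpr fun h => hk ((hq.zpow_eq_one_iff_dvd k).mp h)
    have hgeom := mul_geom_sum (q ^ k) n
    rw [zpow_pow_eq_one hq, sub_self] at hgeom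
    exact (mul_eq_zero.mp hgeom).resolve_left hne

variable [NeZero n]

theorem zpow_eq_zpow_iff (hq : IsPrimitiveRoot q n) (i j : ℤ) :
    q ^ i = q ^ j ↔ (n : ℤ) ∣ i - j := by
  have hq0 : q ≠ 0 := hq.ne_zero (NeZero.ne n)
  rw [← hq.zpow_eq_one_iff_dvd, zpow_sub₀ hq0, div_eq_one_iff_eq (zpow_ne_zero _ hq0)]

end

variable {K A : Type*} [Field K] [Ring A] [Algebra K A] {n : ℕ} {q : K}

variable (n q) in
/-- The projector onto the eigenspace of `g` for the eigenvalue `q ^ i`, for `q` a primitive `n`-th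
root of unity and `g ^ n = 1`. -/
def eigenProj (g : A) (i : ℤ) : A :=
  (n : K)⁻¹ • ∑ m ∈ Finset.range n, (q ^ (-i) • g) ^ m

theorem commute_eigenProj {g h : A} (hgh : Commute h g) (i : ℤ) :
    Commute h (eigenProj n q g i) :=
  (Commute.sum_right _ _ _ fun _ _ => (hgh.smul_right _).pow_right _).smul_right _

variable [NeZero n]

theorem mul_eigenProj (hq : IsPrimitiveRoot q n) {g : A} (hg : g ^ n = 1) (i : ℤ) :
    g * eigenProj n q g i = q ^ i • eigenProj n q g i := by
  have hq0 : q ≠ 0 := hq.ne_zero (NeZero.ne n)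
  have hgeom := mul_geom_sum (q ^ (-i) • g) n
  rw [smul_pow, zpow_pow_eq_one hq, hg, one_smul, sub_self, sub_mul, one_mul, sub_eq_zero,
    smul_mul_assoc] at hgeom
  rw [eigenProj, mul_smul_comm, smul_comm (q ^ i)]
  congr 1
  conv_rhs => rw [← hgeom, smul_smul, ← zpow_add₀ hq0, add_neg_cancel, zpow_zero, one_smul]

theorem sum_eigenProj (hq : IsPrimitiveRoot q n) (g : A) :
    ∑ i ∈ Finset.range n, eigenProj n q g i = 1 := by
  have hn : (n : K) ≠ 0 := hq.neZero'.out
  have hcoeff (m : ℕ) (hm : m ∈ Finset.range n) :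
      ∑ i ∈ Finset.range n, (q ^ (-(i : ℤ))) ^ m = if m = 0 then (n : K) else 0 := by
    have hdvd : (n : ℤ) ∣ -m ↔ m = 0 := by
      rw [dvd_neg, Int.natCast_dvd_natCast]
      exact ⟨fun h => Nat.eq_zero_of_dvd_of_lt h (Finset.mem_range.mp hm), fun h => h ▸ dvd_zero n⟩
    rw [← if_congr hdvd rfl rfl, ← geom_sum_zpow hq]
    refine Finset.sum_congr rfl fun i _ => ?_
    rw [← zpow_natCast, ← zpow_natCast, ← zpow_mul, ← zpow_mul, neg_mul_comm, mul_comm]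
  calc ∑ i ∈ Finset.range n, eigenProj n q g i
      = (n : K)⁻¹ • ∑ m ∈ Finset.range n, (∑ i ∈ Finset.range n, (q ^ (-(i : ℤ))) ^ m) • g ^ m := by
        simp only [eigenProj, ← Finset.smul_sum, smul_pow, Finset.sum_smul]
        rw [Finset.sum_comm]
    _ = (n : K)⁻¹ • (n : K) • (1 : A) := by
        rw [Finset.sum_congr rfl fun m hm => by rw [hcoeff m hm, ite_smul, zero_smul],
          Finset.sum_ite_eq', if_pos (Finset.mem_range.mpr (NeZero.pos n)), pow_zero]
    _ = 1 := by rw [smul_smul, inv_mul_cancel₀ hn, one_smul]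

theorem eigenProj_smul (hq : IsPrimitiveRoot q n) {M : Type*} [AddCommGroup M] [Module K M]
    [Module A M] [IsScalarTower K A M] {g : A} {u : M} {k : ℤ} (hu : g • u = q ^ k • u) (i : ℤ) :
    eigenProj n q g i • u = if (n : ℤ) ∣ k - i then u else 0 := by
  have hq0 : q ≠ 0 := hq.ne_zero (NeZero.ne n)
  have hn : (n : K) ≠ 0 := hq.neZero'.out
  have hu' : (q ^ (-i) • g) • u = q ^ (k - i) • u := by
    rw [smul_assoc, hu, smul_smul, ← zpow_add₀ hq0, neg_add_eq_sub]
  have hpow (m : ℕ) : (q ^ (-i) • g) ^ m • u = (q ^ (k - i)) ^ m • u := by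
    induction m with
    | zero => simp only [pow_zero, one_smul]
    | succ m ih => rw [pow_succ, mul_smul, hu', smul_algebra_smul_comm, ih, smul_smul, ← pow_succ']
  rw [eigenProj, smul_assoc, Finset.sum_smul, Finset.sum_congr rfl fun m _ => hpow m,
    ← Finset.sum_smul, geom_sum_zpow hq]
  split_ifs
  · rw [smul_smul, inv_mul_cancel₀ hn, one_smul]
  · rw [zero_smul, smul_zero]

end EigenProj

namespace HnZero

noncomputable section

variable {K : Type u} [Field K] {n : ℕ} {q : K}

theorem induction_on {p : HnZero n q → Prop} (h : HnZero n q) (gen : ∀ g, p (gen n q g))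
    (algebraMap : ∀ r, p (algebraMap K _ r)) (add : ∀ x y, p x → p y → p (x + y))
    (mul : ∀ x y, p x → p y → p (x * y)) : p h :=
  let B : Subalgebra K (HnZero n q) :=
    { carrier := {h | p h}
      mul_mem' := fun {x y} hx hy => mul x y hx hy
      add_mem' := fun {x y} hx hy => add x y hx hy
      algebraMap_mem' := algebraMap }
  (eq_top_of_gen_mem B gen ▸ Algebra.mem_top : h ∈ B)

section Generators

variable {M N : Type*} [AddCommGroup M] [Module K M] [Module (HnZero n q) M]
  [IsScalarTower K (HnZero n q) M] [AddCommGroup N] [Module K N] [Module (HnZero n q) N]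
  [IsScalarTower K (HnZero n q) N]

/-- The homomorphism of modules that sends the vectors of a basis `e` to the vectors `v`, provided
that this is compatible with the action of the generators. -/
def homOfBasis {ι : Type*} (e : Module.Basis ι K M) (v : ι → N)
    (hv : ∀ g p, e.constr K v (gen n q g • e p) = gen n q g • v p) : M →ₗ[HnZero n q] N :=
  { e.constr K v with
    map_smul' := fun h =>
      induction_on (p := fun h => ∀ x, e.constr K v (h • x) = h • e.constr K v x) h
        (fun g => LinearMap.congr_fun (f := e.constr K v ∘ₗ Algebra.lsmul K K M (gen n q g))
          (g := Algebra.lsmul K K N (gen n q g) ∘ₗ e.constr K v) <| e.ext fun p => by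
            rw [LinearMap.comp_apply, LinearMap.comp_apply, e.constr_basis]
            exact hv g p)
        (fun r x => by rw [algebraMap_smul, algebraMap_smul, map_smul])
        (fun g h hg hh x => by rw [add_smul, map_add, hg, hh, add_smul])
        (fun g h hg hh x => by rw [mul_smul, hg, hh, mul_smul]) }

theorem homOfBasis_apply {ι : Type*} (e : Module.Basis ι K M) (v : ι → N)
    (hv : ∀ g p, e.constr K v (gen n q g • e p) = gen n q g • v p) (x : M) :
    homOfBasis e v hv x = e.constr K v x := rfl

/-- The submodule given by a subspace that is stable under the generators. -/
def submoduleOfGen (W : Submodule K M) (hW : ∀ g, ∀ x ∈ W, gen n q g • x ∈ W) :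
    Submodule (HnZero n q) M :=
  { W with
    smul_mem' := fun h x =>
      induction_on (p := fun h => ∀ x ∈ W, h • x ∈ W) h hW
        (fun r x hx => by rw [algebraMap_smul]; exact W.smul_mem _ hx)
        (fun g h hg hh x hx => by rw [add_smul]; exact W.add_mem (hg _ hx) (hh _ hx))
        (fun g h hg hh x hx => by rw [mul_smul]; exact hg _ (hh _ hx)) x }

theorem smul_eq_zero_of_isSimpleModule [IsSimpleModule (HnZero n q) M] {h : HnZero n q}
    (hh : IsNilpotent h) (hg : ∀ g, ∃ r : K, h * gen n q g = r • (gen n q g * h)) (x : M) :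
    h • x = 0 := by
  have : Nontrivial M := IsSimpleModule.nontrivial (HnZero n q) M
  let f := Algebra.lsmul K K M h
  let N : Submodule (HnZero n q) M := submoduleOfGen (LinearMap.ker f) fun g x hx => by
    obtain ⟨r, hr⟩ := hg g
    have hx : h • x = 0 := hx
    change h • gen n q g • x = 0
    rw [← mul_smul, hr, smul_assoc, mul_smul, hx, smul_zero, smul_zero]
  rcases eq_bot_or_eq_top N with hN | hN
  · have hf : Function.Injective f := LinearMap.ker_eq_bot.mp <| (Submodule.eq_bot_iff _).mpr
      fun y hy => (Submodule.mem_bot _).mp (hN ▸ (show y ∈ N from hy))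
    obtain ⟨m, hm⟩ : IsNilpotent f := hh.map (Algebra.lsmul K K M)
    have hinj : Function.Injective (f ^ m) := Module.End.coe_pow f m ▸ hf.iterate m
    obtain ⟨y, hy⟩ := exists_ne (0 : M)
    exact absurd (hinj (by rw [hm, LinearMap.zero_apply, LinearMap.zero_apply])) hy
  · exact (hN ▸ Submodule.mem_top : x ∈ N)

theorem a_smul_of_isSimpleModule (hq : q ≠ 0) [IsSimpleModule (HnZero n q) M] (x : M) :
    gen n q .a • x = 0 := by
  have hr := relations n q
  refine smul_eq_zero_of_isSimpleModule ⟨n, hr.an⟩ (fun g => ?_) x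
  cases g
  · exact ⟨1, (one_smul _ _).symm⟩
  · exact ⟨q⁻¹, by rw [hr.ba, inv_smul_smul₀ hq]⟩
  · exact ⟨q⁻¹, by rw [hr.ca, inv_smul_smul₀ hq]⟩
  · exact ⟨q⁻¹, by rw [hr.da, inv_smul_smul₀ hq]⟩

theorem d_smul_of_isSimpleModule [IsSimpleModule (HnZero n q) M] (x : M) : gen n q .d • x = 0 := by
  have hr := relations n q
  refine smul_eq_zero_of_isSimpleModule ⟨n, hr.dn⟩ (fun g => ?_) x
  cases g
  · exact ⟨q, hr.da⟩
  · exact ⟨q, hr.db⟩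
  · exact ⟨q, hr.dc⟩
  · exact ⟨1, (one_smul _ _).symm⟩

variable (n q) in
/-- `u` is a weight vector of weight `(i, j)`: `b` acts on it as `q ^ i` and `c` as `q ^ j`. -/
structure IsWeight (i j : ℤ) (u : M) : Prop where
  b : gen n q .b • u = q ^ i • u
  c : gen n q .c • u = q ^ j • u

theorem IsWeight.map {i j : ℤ} {u : M} (hu : IsWeight n q i j u) (f : M →ₗ[HnZero n q] N) :
    IsWeight n q i j (f u) :=
  ⟨by rw [← map_smul, hu.b, LinearMap.map_smul_of_tower],
    by rw [← map_smul, hu.c, LinearMap.map_smul_of_tower]⟩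

variable (n q) in
/-- The projector onto the space of vectors of weight `(i, j)`. -/
def weightProj (i j : ℤ) : HnZero n q :=
  eigenProj n q (gen n q .b) i * eigenProj n q (gen n q .c) j

variable [NeZero n]

theorem isWeight_weightProj (hq : IsPrimitiveRoot q n) (i j : ℤ) :
    IsWeight n q i j (weightProj n q i j) := by
  constructor
  · rw [smul_eq_mul, weightProj, ← mul_assoc, mul_eigenProj hq (relations n q).bn, smul_mul_assoc]
  · have hbc : Commute (gen n q .c) (gen n q .b) := (relations n q).bc.symm
    rw [smul_eq_mul, weightProj, ← mul_assoc, (commute_eigenProj hbc i).eq, mul_assoc,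
      mul_eigenProj hq (relations n q).cn, mul_smul_comm]

theorem weightProj_smul (hq : IsPrimitiveRoot q n) {u : M} {k l : ℤ} (hu : IsWeight n q k l u)
    (i j : ℤ) :
    weightProj n q i j • u = if (n : ℤ) ∣ k - i ∧ (n : ℤ) ∣ l - j then u else 0 := by
  rw [weightProj, mul_smul, eigenProj_smul hq hu.c, smul_ite, smul_zero, eigenProj_smul hq hu.b,
    ← ite_and]
  exact if_congr and_comm rfl rfl

theorem sum_weightProj (hq : IsPrimitiveRoot q n) :
    ∑ i ∈ Finset.range n, ∑ j ∈ Finset.range n, weightProj n q i j = 1 := by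
  simp only [weightProj]
  rw [← Finset.sum_mul_sum, sum_eigenProj hq, sum_eigenProj hq, mul_one]

end Generators

theorem exists_weightProj_smul_ne_zero [NeZero n] (hq : IsPrimitiveRoot q n) {M : Type*}
    [AddCommGroup M] [Module (HnZero n q) M] {x : M} (hx : x ≠ 0) :
    ∃ i j : ℤ, weightProj n q i j • x ≠ 0 := by
  by_contra! h
  apply hx
  rw [← one_smul (HnZero n q) x, ← sum_weightProj hq, Finset.sum_smul]
  exact Finset.sum_eq_zero fun i _ => by
    rw [Finset.sum_smul]
    exact Finset.sum_eq_zero fun j _ => h i j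

end

end HnZero

/-! ## One-dimensional modules -/

theorem eq_top_of_basis_mem {K A M ι : Type*} [CommSemiring K] [Semiring A] [Algebra K A]
    [AddCommMonoid M] [Module K M] [Module A M] [IsScalarTower K A M] (e : Module.Basis ι K M)
    {N : Submodule A M} (h : ∀ p, e p ∈ N) : N = ⊤ := by
  rw [← Submodule.restrictScalars_eq_top_iff K A M, eq_top_iff, ← e.span_eq, Submodule.span_le]
  rintro _ ⟨p, rfl⟩
  exact h p

namespace HnZero

noncomputable section

variable {K : Type u} [Field K] {n : ℕ} {q : K}

section Weight

variable {M : Type*} [AddCommGroup M] [Module K M] [Module (HnZero n q) M]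
  [IsScalarTower K (HnZero n q) M] {i j : ℤ} {u : M}

namespace IsWeight

theorem a_smul (hq : q ≠ 0) (hu : IsWeight n q i j u) :
    IsWeight n q (i + 1) (j + 1) (gen n q .a • u) := by
  constructor
  · rw [← mul_smul, (relations n q).ba, smul_assoc, mul_smul, hu.b, smul_algebra_smul_comm,
      smul_smul, ← zpow_one_add₀ hq, add_comm]
  · rw [← mul_smul, (relations n q).ca, smul_assoc, mul_smul, hu.c, smul_algebra_smul_comm,
      smul_smul, ← zpow_one_add₀ hq, add_comm]

theorem d_smul (hq : q ≠ 0) (hu : IsWeight n q i j u) :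
    IsWeight n q (i - 1) (j - 1) (gen n q .d • u) := by
  constructor
  · rw [← mul_smul, ← inv_smul_smul₀ hq (gen n q .b * gen n q .d), ← (relations n q).db,
      smul_assoc, mul_smul, hu.b, smul_algebra_smul_comm, smul_smul, mul_comm, ← zpow_sub_one₀ hq]
  · rw [← mul_smul, ← inv_smul_smul₀ hq (gen n q .c * gen n q .d), ← (relations n q).dc,
      smul_assoc, mul_smul, hu.c, smul_algebra_smul_comm, smul_smul, mul_comm, ← zpow_sub_one₀ hq]

theorem monomial_smul (hq : q ≠ 0) (hu : IsWeight n q i j u) (k l : ℕ) :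
    IsWeight n q (i + k - l) (j + k - l) (gen n q .a ^ k • gen n q .d ^ l • u) := by
  induction k with
  | zero =>
    rw [pow_zero, one_smul, Nat.cast_zero, add_zero, add_zero]
    induction l with
    | zero => simpa only [pow_zero, one_smul, Nat.cast_zero, sub_zero] using hu
    | succ l ih =>
      rw [pow_succ', mul_smul, Nat.cast_succ, ← sub_sub, ← sub_sub]
      exact ih.d_smul hq
  | succ k ih =>
    rw [pow_succ', mul_smul, Nat.cast_succ, ← add_assoc, ← add_assoc, add_sub_right_comm _ 1,
      add_sub_right_comm _ 1]
    exact ih.a_smul hq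

end IsWeight

end Weight

section GridOperators

variable (K n) in
/-- The space with basis `Fin n × Fin n`. -/
abbrev GridSpace : Type u := Fin n × Fin n → K

variable (K n) in
/-- The basis vectors of `GridSpace`, extended by zero to all pairs of natural numbers. -/
def gridVec (k l : ℕ) : GridSpace K n :=
  if h : k < n ∧ l < n then Pi.single (⟨k, h.1⟩, ⟨l, h.2⟩) 1 else 0

theorem gridVec_fin (p : Fin n × Fin n) : gridVec K n p.1 p.2 = Pi.basisFun K _ p := by
  rw [gridVec, dif_pos ⟨p.1.2, p.2.2⟩, Pi.basisFun_apply]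

theorem gridVec_eq_zero {k l : ℕ} (h : ¬ (k < n ∧ l < n)) : gridVec K n k l = 0 := dif_neg h

variable {V : Type*} [AddCommGroup V] [Module K V]

/-- The linear map with prescribed values on the basis vectors. -/
def gridMap (f : ℕ → ℕ → V) : GridSpace K n →ₗ[K] V :=
  (Pi.basisFun K (Fin n × Fin n)).constr K fun p => f p.1 p.2

theorem gridMap_gridVec {f : ℕ → ℕ → V} (hf : ∀ k l, ¬ (k < n ∧ l < n) → f k l = 0) (k l : ℕ) :
    gridMap f (gridVec K n k l) = f k l := by
  by_cases h : k < n ∧ l < n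
  · have hvec := gridVec_fin (K := K) (⟨k, h.1⟩, ⟨l, h.2⟩)
    rw [hvec, gridMap, Module.Basis.constr_basis]
  · rw [gridVec_eq_zero h, map_zero, hf k l h]

theorem grid_hom_ext {f g : GridSpace K n →ₗ[K] V}
    (h : ∀ k l, f (gridVec K n k l) = g (gridVec K n k l)) : f = g :=
  (Pi.basisFun K (Fin n × Fin n)).ext fun p => by rw [← gridVec_fin, h]

variable (K n) in
/-- The operator by which `a` acts on an induced module. -/
def opA : Module.End K (GridSpace K n) := gridMap fun k l => gridVec K n (k + 1) l

variable (n q) in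
/-- The operator by which `d` acts on an induced module. -/
def opD : Module.End K (GridSpace K n) := gridMap fun k l => q ^ k • gridVec K n k (l + 1)

variable (n q) in
/-- The operator by which `b` (`c`) acts on a module induced from a weight with first (second)
component `i`. -/
def opWeight (i : ℤ) : Module.End K (GridSpace K n) :=
  gridMap fun k l => q ^ (i + k - l) • gridVec K n k l

theorem opA_gridVec (k l : ℕ) : opA K n (gridVec K n k l) = gridVec K n (k + 1) l :=
  gridMap_gridVec (fun _ _ h => gridVec_eq_zero (by omega)) k l

theorem opD_gridVec (k l : ℕ) : opD n q (gridVec K n k l) = q ^ k • gridVec K n k (l + 1) :=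
  gridMap_gridVec (f := fun k l => q ^ k • gridVec K n k (l + 1))
    (fun _ _ h => by rw [gridVec_eq_zero (by omega), smul_zero]) k l

theorem opWeight_gridVec (i : ℤ) (k l : ℕ) :
    opWeight n q i (gridVec K n k l) = q ^ (i + k - l) • gridVec K n k l :=
  gridMap_gridVec (f := fun k l => q ^ (i + k - l) • gridVec K n k l)
    (fun _ _ h => by rw [gridVec_eq_zero h, smul_zero]) k l

theorem opA_pow_gridVec (m k l : ℕ) : (opA K n ^ m) (gridVec K n k l) = gridVec K n (k + m) l := by
  induction m with
  | zero => rfl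
  | succ m ih => rw [pow_succ', Module.End.mul_apply, ih, opA_gridVec, add_assoc]

theorem opD_pow_gridVec (m k l : ℕ) :
    (opD n q ^ m) (gridVec K n k l) = q ^ (k * m) • gridVec K n k (l + m) := by
  induction m with
  | zero => rw [mul_zero, pow_zero, pow_zero, one_smul, Module.End.one_apply, add_zero]
  | succ m ih =>
    rw [pow_succ', Module.End.mul_apply, ih, map_smul, opD_gridVec, smul_smul, ← pow_add,
      add_assoc, mul_add_one]

theorem opWeight_pow_gridVec (i : ℤ) (m k l : ℕ) :
    (opWeight n q i ^ m) (gridVec K n k l) = (q ^ (i + k - l)) ^ m • gridVec K n k l := by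
  induction m with
  | zero => rw [pow_zero, pow_zero, one_smul, Module.End.one_apply]
  | succ m ih =>
    rw [pow_succ', Module.End.mul_apply, ih, map_smul, opWeight_gridVec, smul_smul, ← pow_succ]

theorem opA_pow_eq_zero : opA K n ^ n = 0 := grid_hom_ext fun k l => by
  rw [opA_pow_gridVec, gridVec_eq_zero (by omega), LinearMap.zero_apply]

theorem opD_pow_eq_zero : opD n q ^ n = 0 := grid_hom_ext fun k l => by
  rw [opD_pow_gridVec, gridVec_eq_zero (by omega), smul_zero, LinearMap.zero_apply]

theorem opWeight_pow_eq_one (hq : IsPrimitiveRoot q n) (i : ℤ) : opWeight n q i ^ n = 1 :=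
  grid_hom_ext fun k l => by
    rw [opWeight_pow_gridVec, zpow_pow_eq_one hq, one_smul, Module.End.one_apply]

theorem opWeight_mul_opA (hq : q ≠ 0) (i : ℤ) :
    opWeight n q i * opA K n = q • (opA K n * opWeight n q i) := grid_hom_ext fun k l => by
  rw [Module.End.mul_apply, opA_gridVec, opWeight_gridVec, LinearMap.smul_apply,
    Module.End.mul_apply, opWeight_gridVec, map_smul, opA_gridVec, smul_smul, ← zpow_one_add₀ hq]
  congr 2
  push_cast
  ring

theorem opD_mul_opWeight (hq : q ≠ 0) (i : ℤ) :
    opD n q * opWeight n q i = q • (opWeight n q i * opD n q) := grid_hom_ext fun k l => by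
  rw [Module.End.mul_apply, opWeight_gridVec, map_smul, opD_gridVec, LinearMap.smul_apply,
    Module.End.mul_apply, opD_gridVec, map_smul, opWeight_gridVec, smul_comm (q ^ k), smul_smul q,
    ← zpow_one_add₀ hq]
  congr 2
  push_cast
  ring

theorem opD_mul_opA : opD n q * opA K n = q • (opA K n * opD n q) := grid_hom_ext fun k l => by
  rw [Module.End.mul_apply, opA_gridVec, opD_gridVec, LinearMap.smul_apply, Module.End.mul_apply,
    opD_gridVec, map_smul, opA_gridVec, smul_smul, ← pow_succ']

theorem opWeight_comm (i j : ℤ) :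
    opWeight n q i * opWeight n q j = opWeight n q j * opWeight n q i :=
  grid_hom_ext fun k l => by
    rw [Module.End.mul_apply, Module.End.mul_apply, opWeight_gridVec, opWeight_gridVec, map_smul,
      map_smul, opWeight_gridVec, opWeight_gridVec, smul_comm]

theorem relations_grid [NeZero n] (hq : IsPrimitiveRoot q n) (i j : ℤ) :
    Relations n q (opA K n) (opWeight n q i) (opWeight n q j) (opD n q) :=
  have hq0 : q ≠ 0 := hq.ne_zero (NeZero.ne n)
  { ba := opWeight_mul_opA hq0 i
    db := opD_mul_opWeight hq0 i
    ca := opWeight_mul_opA hq0 j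
    dc := opD_mul_opWeight hq0 j
    bc := opWeight_comm i j
    an := opA_pow_eq_zero
    bn := opWeight_pow_eq_one hq i
    cn := opWeight_pow_eq_one hq j
    dn := opD_pow_eq_zero
    da := opD_mul_opA }

end GridOperators

variable [NeZero n] [hq : Fact (IsPrimitiveRoot q n)]

section OneDim

variable (n q) in
/-- The character of weight `(i, j)`. -/
def character (i j : ℤ) : HnZero n q →ₐ[K] K :=
  lift (relations_scalar (NeZero.ne n) (zpow_pow_eq_one hq.out i) (zpow_pow_eq_one hq.out j))

variable (n q) in
/-- The one-dimensional module of weight `(i, j)`. -/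
def oneDim (i j : ℤ) : FDModule K (HnZero n q) := FDModule.char (character n q i j)

variable (n q) in
/-- The basis vector `1` of `oneDim`. -/
def oneVec (i j : ℤ) : oneDim n q i j := (1 : K)

variable (n q) in
/-- The vector `oneVec` as a basis. -/
def oneBasis (i j : ℤ) : Module.Basis Unit K (oneDim n q i j) := Module.Basis.singleton Unit K

@[simp]
theorem oneBasis_apply (i j : ℤ) (x : Unit) : oneBasis n q i j x = oneVec n q i j :=
  Module.Basis.singleton_apply Unit K x

variable {i j : ℤ}

theorem smul_oneVec (h : HnZero n q) :
    h • oneVec n q i j = character n q i j h • oneVec n q i j := rfl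

theorem gen_smul_oneVec (g : Gen) :
    gen n q g • oneVec n q i j = genMap 0 (q ^ i) (q ^ j) 0 g • oneVec n q i j := by
  rw [smul_oneVec, character, lift_gen]

theorem isWeight_oneVec : IsWeight n q i j (oneVec n q i j) :=
  ⟨gen_smul_oneVec .b, gen_smul_oneVec .c⟩

theorem a_smul_oneVec : gen n q .a • oneVec n q i j = 0 :=
  (gen_smul_oneVec .a).trans (zero_smul K _)

theorem d_smul_oneVec : gen n q .d • oneVec n q i j = 0 :=
  (gen_smul_oneVec .d).trans (zero_smul K _)

theorem oneVec_ne_zero : oneVec n q i j ≠ 0 := one_ne_zero (α := K)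

theorem eq_top_of_oneVec_mem {N : Submodule (HnZero n q) (oneDim n q i j)}
    (h : oneVec n q i j ∈ N) : N = ⊤ :=
  eq_top_of_basis_mem (oneBasis n q i j) fun _ => by rwa [oneBasis_apply]

theorem oneDim_congr {i' j' : ℤ} (hi : (n : ℤ) ∣ i - i') (hj : (n : ℤ) ∣ j - j') :
    oneDim n q i j = oneDim n q i' j' := by
  suffices character n q i j = character n q i' j' by rw [oneDim, oneDim, this]
  refine hom_ext fun g => ?_
  rw [character, character, lift_gen, lift_gen, (zpow_eq_zpow_iff hq.out i i').mpr hi,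
    (zpow_eq_zpow_iff hq.out j j').mpr hj]

instance isSimpleModule_oneDim (i j : ℤ) : IsSimpleModule (HnZero n q) (oneDim n q i j) := by
  have : Nontrivial (oneDim n q i j) := ⟨⟨_, 0, oneVec_ne_zero⟩⟩
  refine { eq_bot_or_eq_top := fun N => or_iff_not_imp_left.mpr fun hN => ?_ }
  obtain ⟨x, hx, hx0⟩ := N.exists_mem_ne_zero_of_ne_bot hN
  obtain ⟨r, rfl⟩ : ∃ r : K, r • oneVec n q i j = x := ⟨x, mul_one (M := K) x⟩
  refine eq_top_of_oneVec_mem ?_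
  rw [← inv_smul_smul₀ (left_ne_zero_of_smul hx0) (oneVec n q i j)]
  exact N.smul_of_tower_mem r⁻¹ hx

variable {M : Type*} [AddCommGroup M] [Module K M] [Module (HnZero n q) M]
  [IsScalarTower K (HnZero n q) M] {u : M}

/-- The homomorphism `oneVec ↦ u`, for a weight vector `u` that `a` and `d` annihilate. -/
def oneDimHom (hu : IsWeight n q i j u) (ha : gen n q .a • u = 0) (hd : gen n q .d • u = 0) :
    oneDim n q i j →ₗ[HnZero n q] M :=
  homOfBasis (oneBasis n q i j) (fun _ => u) fun g x => by
    rw [oneBasis_apply, gen_smul_oneVec, map_smul, ← oneBasis_apply i j x,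
      Module.Basis.constr_basis]
    cases g
    · exact (zero_smul K u).trans ha.symm
    · exact hu.b.symm
    · exact hu.c.symm
    · exact (zero_smul K u).trans hd.symm

theorem oneDimHom_oneVec (hu : IsWeight n q i j u) (ha : gen n q .a • u = 0)
    (hd : gen n q .d • u = 0) : oneDimHom hu ha hd (oneVec n q i j) = u := by
  rw [oneDimHom, homOfBasis_apply, ← oneBasis_apply i j (), Module.Basis.constr_basis]

theorem exists_equiv_oneDim [IsSimpleModule (HnZero n q) M] :
    ∃ i j : ℤ, Nonempty (oneDim n q i j ≃ₗ[HnZero n q] M) := by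
  have : Nontrivial M := IsSimpleModule.nontrivial (HnZero n q) M
  obtain ⟨x, hx⟩ := exists_ne (0 : M)
  obtain ⟨i, j, hu⟩ := exists_weightProj_smul_ne_zero hq.out hx
  have hweight : IsWeight n q i j (weightProj n q i j • x) :=
    (isWeight_weightProj hq.out i j).map (LinearMap.toSpanSingleton (HnZero n q) M x)
  let f := oneDimHom hweight (a_smul_of_isSimpleModule (hq.out.ne_zero (NeZero.ne n)) _)
    (d_smul_of_isSimpleModule _)
  have hf : f ≠ 0 := fun h => hu (by
    rw [← oneDimHom_oneVec hweight _ (d_smul_of_isSimpleModule _)]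
    exact LinearMap.congr_fun h _)
  exact ⟨i, j, ⟨LinearEquiv.ofBijective f ((LinearMap.bijective_or_eq_zero f).resolve_right hf)⟩⟩

end OneDim

end

end HnZero

/-! ## Induced modules -/

namespace HnZero

noncomputable section

variable {K : Type u} [Field K] {n : ℕ} {q : K} [NeZero n] [hq : Fact (IsPrimitiveRoot q n)]

section Induced

variable (n q) in
/-- The module induced from the one-dimensional module of weight `(i, j)` over the subalgebra
generated by `b` and `c`: it is generated by a vector of weight `(i, j)`, with no further
relations. -/
def induced (i j : ℤ) : FDModule K (HnZero n q) := FDModule.ofRep (lift (relations_grid hq.out i j))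

variable (n q) in
/-- The vector `a ^ k • d ^ l • u` of `induced`, for the generator `u` of weight `(i, j)`. -/
def inducedVec (i j : ℤ) (k l : ℕ) : induced n q i j := gridVec K n k l

variable (n q) in
/-- The basis of the vectors `inducedVec n q i j k l` with `k, l < n`. -/
def inducedBasis (i j : ℤ) : Module.Basis (Fin n × Fin n) K (induced n q i j) := Pi.basisFun K _

variable {i j : ℤ}

theorem inducedBasis_apply (p : Fin n × Fin n) :
    inducedBasis n q i j p = inducedVec n q i j p.1 p.2 := (gridVec_fin p).symm

theorem finrank_induced : Module.finrank K (induced n q i j) = n * n := by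
  rw [Module.finrank_eq_card_basis (inducedBasis n q i j), Fintype.card_prod, Fintype.card_fin]

theorem gen_smul_inducedVec (g : Gen) (k l : ℕ) : gen n q g • inducedVec n q i j k l =
    genMap (opA K n) (opWeight n q i) (opWeight n q j) (opD n q) g (gridVec K n k l) := by
  rw [← lift_gen (relations_grid hq.out i j)]; rfl

theorem a_smul_inducedVec (k l : ℕ) :
    gen n q .a • inducedVec n q i j k l = inducedVec n q i j (k + 1) l :=
  (gen_smul_inducedVec .a k l).trans (opA_gridVec k l)

theorem d_smul_inducedVec (k l : ℕ) :
    gen n q .d • inducedVec n q i j k l = q ^ k • inducedVec n q i j k (l + 1) :=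
  (gen_smul_inducedVec .d k l).trans (opD_gridVec k l)

theorem isWeight_inducedVec (k l : ℕ) :
    IsWeight n q (i + k - l) (j + k - l) (inducedVec n q i j k l) :=
  ⟨(gen_smul_inducedVec .b k l).trans (opWeight_gridVec i k l),
    (gen_smul_inducedVec .c k l).trans (opWeight_gridVec j k l)⟩

variable (n q i j) in
theorem isWeight_inducedVec_zero : IsWeight n q i j (inducedVec n q i j 0 0) := by
  simpa only [Nat.cast_zero, add_zero, sub_zero] using
    isWeight_inducedVec (n := n) (q := q) (i := i) (j := j) 0 0

theorem inducedVec_eq_smul (k l : ℕ) :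
    inducedVec n q i j k l = gen n q .a ^ k • gen n q .d ^ l • inducedVec n q i j 0 0 := by
  induction k with
  | zero =>
    rw [pow_zero, one_smul]
    induction l with
    | zero => rw [pow_zero, one_smul]
    | succ l ih => rw [pow_succ', mul_smul, ← ih, d_smul_inducedVec, pow_zero, one_smul]
  | succ k ih => rw [pow_succ', mul_smul, ← ih, a_smul_inducedVec]

theorem eq_top_of_inducedVec_mem {N : Submodule (HnZero n q) (induced n q i j)}
    (h : ∀ k l, inducedVec n q i j k l ∈ N) : N = ⊤ :=
  eq_top_of_basis_mem (inducedBasis n q i j) fun p => by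
    rw [inducedBasis_apply]
    exact h _ _

theorem induced_hom_ext {M : Type*} [AddCommGroup M] [Module (HnZero n q) M]
    {f g : induced n q i j →ₗ[HnZero n q] M}
    (h : f (inducedVec n q i j 0 0) = g (inducedVec n q i j 0 0)) : f = g := by
  have htop : LinearMap.eqLocus f g = ⊤ := eq_top_of_inducedVec_mem fun k l => by
    rw [LinearMap.mem_eqLocus, inducedVec_eq_smul, map_smul, map_smul, map_smul, map_smul, h]
  exact LinearMap.ext fun x => (htop ▸ Submodule.mem_top : x ∈ LinearMap.eqLocus f g)

variable {M : Type*} [AddCommGroup M] [Module K M] [Module (HnZero n q) M]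
  {u : M}

theorem constr_inducedVec (k l : ℕ) :
    (inducedBasis n q i j).constr K (fun p => gen n q .a ^ (p.1 : ℕ) • gen n q .d ^ (p.2 : ℕ) • u)
      (inducedVec n q i j k l) = gen n q .a ^ k • gen n q .d ^ l • u := by
  refine gridMap_gridVec (f := fun k l => gen n q .a ^ k • gen n q .d ^ l • u) (fun k l h => ?_) k l
  by_cases hk : k < n
  · rw [pow_eq_zero_of_le (by omega : n ≤ l) (relations n q).dn, zero_smul, smul_zero]
  · rw [pow_eq_zero_of_le (not_lt.mp hk) (relations n q).an, zero_smul]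

variable [IsScalarTower K (HnZero n q) M]

/-- The homomorphism from `induced` that sends the generator to a given weight vector. -/
def inducedHom (hu : IsWeight n q i j u) : induced n q i j →ₗ[HnZero n q] M :=
  homOfBasis (inducedBasis n q i j)
    (fun p => gen n q .a ^ (p.1 : ℕ) • gen n q .d ^ (p.2 : ℕ) • u) fun g p => by
      have hq0 : q ≠ 0 := hq.out.ne_zero (NeZero.ne n)
      rw [inducedBasis_apply]
      cases g
      · rw [a_smul_inducedVec, constr_inducedVec, pow_succ', mul_smul]
      · rw [(isWeight_inducedVec _ _).b, map_smul, constr_inducedVec, (hu.monomial_smul hq0 _ _).b]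
      · rw [(isWeight_inducedVec _ _).c, map_smul, constr_inducedVec, (hu.monomial_smul hq0 _ _).c]
      · rw [d_smul_inducedVec, map_smul, constr_inducedVec, ← mul_smul (gen n q .d),
          QBinomial.mul_pow_skew (relations n q).da, smul_assoc, mul_smul, pow_succ', mul_smul]

theorem inducedHom_inducedVec (hu : IsWeight n q i j u) (k l : ℕ) :
    inducedHom hu (inducedVec n q i j k l) = gen n q .a ^ k • gen n q .d ^ l • u := by
  rw [inducedHom, homOfBasis_apply, constr_inducedVec]

theorem inducedHom_inducedVec_zero (hu : IsWeight n q i j u) :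
    inducedHom hu (inducedVec n q i j 0 0) = u := by
  rw [inducedHom_inducedVec, pow_zero, pow_zero, one_smul, one_smul]

end Induced

section ProjectiveCover

instance projective_induced (i j : ℤ) : Module.Projective (HnZero n q) (induced n q i j) := by
  refine Module.Projective.of_split (inducedHom (isWeight_weightProj hq.out i j))
    (LinearMap.toSpanSingleton (HnZero n q) _ (inducedVec n q i j 0 0)) (induced_hom_ext ?_)
  rw [LinearMap.comp_apply, inducedHom_inducedVec_zero, LinearMap.toSpanSingleton_apply,
    weightProj_smul hq.out (isWeight_inducedVec_zero n q i j), sub_self, sub_self,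
    if_pos ⟨dvd_zero _, dvd_zero _⟩, LinearMap.id_apply]

variable (n q) in
/-- The epimorphism from `induced` onto `oneDim`, a projective cover. -/
def coverMap (i j : ℤ) : induced n q i j →ₗ[HnZero n q] oneDim n q i j :=
  inducedHom isWeight_oneVec

variable {i j : ℤ}

theorem surjective_coverMap : Function.Surjective (coverMap n q i j) :=
  LinearMap.range_eq_top.mp (eq_top_of_oneVec_mem ⟨_, inducedHom_inducedVec_zero _⟩)

theorem ker_coverMap_le_of_isSimpleModule {M : Type*} [AddCommGroup M] [Module K M]
    [Module (HnZero n q) M] [IsScalarTower K (HnZero n q) M] [IsSimpleModule (HnZero n q) M]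
    (f : induced n q i j →ₗ[HnZero n q] M) :
    LinearMap.ker (coverMap n q i j) ≤ LinearMap.ker f := by
  have hq0 : q ≠ 0 := hq.out.ne_zero (NeZero.ne n)
  have hfactor : f = oneDimHom ((isWeight_inducedVec_zero n q i j).map f)
      (a_smul_of_isSimpleModule hq0 _) (d_smul_of_isSimpleModule _) ∘ₗ coverMap n q i j :=
    induced_hom_ext (by
      rw [LinearMap.comp_apply, coverMap, inducedHom_inducedVec_zero, oneDimHom_oneVec])
  rw [hfactor]
  exact LinearMap.ker_le_ker_comp _ _

theorem superfluous_ker_coverMap (N : Submodule (HnZero n q) (induced n q i j))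
    (hN : N ⊔ LinearMap.ker (coverMap n q i j) = ⊤) : N = ⊤ := by
  have : IsNoetherian (HnZero n q) (induced n q i j) := isNoetherian_of_tower K inferInstance
  refine (eq_top_or_exists_le_coatom N).resolve_right ?_
  rintro ⟨L, hL, hNL⟩
  have : IsSimpleModule (HnZero n q) (induced n q i j ⧸ L) := isSimpleModule_iff_isCoatom.mpr hL
  have hker : LinearMap.ker (coverMap n q i j) ≤ L := by
    simpa only [Submodule.ker_mkQ] using ker_coverMap_le_of_isSimpleModule L.mkQ
  exact hL.1 (top_le_iff.mp (hN ▸ sup_le hNL hker))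

theorem isProjectiveCover_induced : (induced n q i j).IsProjectiveCover (oneDim n q i j) :=
  ⟨projective_induced i j, coverMap n q i j, surjective_coverMap, superfluous_ker_coverMap⟩

theorem exists_surjective_oneDim (M : Type*) [AddCommGroup M] [Module K M] [Module.Finite K M]
    [Module (HnZero n q) M] [IsScalarTower K (HnZero n q) M] [Nontrivial M] :
    ∃ i j : ℤ, ∃ f : M →ₗ[HnZero n q] oneDim n q i j, Function.Surjective f := by
  have : IsNoetherian (HnZero n q) M := isNoetherian_of_tower K inferInstance
  obtain ⟨N, hN, -⟩ := (eq_top_or_exists_le_coatom (⊥ : Submodule (HnZero n q) M)).resolve_left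
    bot_ne_top
  have : IsSimpleModule (HnZero n q) (M ⧸ N) := isSimpleModule_iff_isCoatom.mpr hN
  obtain ⟨i, j, ⟨e⟩⟩ := exists_equiv_oneDim (n := n) (q := q) (M := M ⧸ N)
  exact ⟨i, j, e.symm.toLinearMap ∘ₗ N.mkQ, e.symm.surjective.comp N.mkQ_surjective⟩

theorem exists_surjective_induced (P : Type*) [AddCommGroup P] [Module K P] [Module.Finite K P]
    [Module (HnZero n q) P] [IsScalarTower K (HnZero n q) P] [Nontrivial P]
    [Module.Projective (HnZero n q) P] :
    ∃ i j : ℤ, ∃ f : P →ₗ[HnZero n q] induced n q i j, Function.Surjective f := by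
  obtain ⟨i, j, f, hf⟩ := exists_surjective_oneDim (n := n) (q := q) P
  obtain ⟨g, rfl⟩ := Module.projective_lifting_property (coverMap n q i j) f surjective_coverMap
  exact ⟨i, j, g,
    FDModule.IsProjectiveCover.surjective_of_comp superfluous_ker_coverMap g hf⟩

end ProjectiveCover

end

end HnZero

/-! ## Tensor products -/

namespace FDModule

noncomputable section

variable {K H : Type u} [Field K] [Ring H] [Bialgebra K H] {M N : FDModule K H}

variable (M N) in
/-- The pure tensors in `M.tensor N`. -/
def pureTensor : M →ₗ[K] N →ₗ[K] M.tensor N := TensorProduct.mk K M N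

theorem smul_pureTensor_eq_act₂ (h : H) (x : M) (y : N) :
    h • pureTensor M N x y = act₂ M.rep N.rep (Coalgebra.comul (R := K) h) (x ⊗ₜ[K] y) := rfl

theorem smul_pureTensor_of_groupLike {g : H} (hg : Coalgebra.comul (R := K) g = g ⊗ₜ[K] g)
    (x : M) (y : N) : g • pureTensor M N x y = pureTensor M N (g • x) (g • y) := by
  rw [smul_pureTensor_eq_act₂, hg, act₂_tmul]
  rfl

section SkewPrimitive

variable {a g : H} (ha : Coalgebra.comul (R := K) a = a ⊗ₜ[K] g + 1 ⊗ₜ[K] a)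
include ha

theorem smul_pureTensor_of_skewPrimitive (x : M) (y : N) :
    a • pureTensor M N x y = pureTensor M N (a • x) (g • y) + pureTensor M N x (a • y) := by
  rw [smul_pureTensor_eq_act₂, ha, map_add, LinearMap.add_apply, act₂_tmul, act₂_tmul, map_one]
  rfl

theorem pow_smul_pureTensor_of_smul_eq_zero {x : M} (hx : a • x = 0) (m : ℕ) (y : N) :
    a ^ m • pureTensor M N x y = pureTensor M N x (a ^ m • y) := by
  induction m with
  | zero => rw [pow_zero, one_smul, one_smul]
  | succ m ih =>
    rw [pow_succ', mul_smul, ih, smul_pureTensor_of_skewPrimitive ha, hx, map_zero,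
      LinearMap.zero_apply, zero_add, mul_smul]

theorem pureTensor_pow_smul_mem {g' : H} (hg : g * g' = 1) {W : Submodule H (M.tensor N)} {x : M}
    (hx : ∀ y, pureTensor M N x y ∈ W) (m : ℕ) (y : N) : pureTensor M N (a ^ m • x) y ∈ W := by
  induction m generalizing y with
  | zero =>
    rw [pow_zero, one_smul]
    exact hx y
  | succ m ih =>
    have h := W.smul_mem a (ih (g' • y))
    rw [smul_pureTensor_of_skewPrimitive ha, ← mul_smul a, ← pow_succ', ← mul_smul g, hg,
      one_smul] at h
    exact (W.add_mem_iff_left (ih _)).mp h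

end SkewPrimitive

theorem eq_top_of_pureTensor_basis_mem {ι κ : Type*} (e : Module.Basis ι K M)
    (f : Module.Basis κ K N) {W : Submodule H (M.tensor N)}
    (h : ∀ r s, pureTensor M N (e r) (f s) ∈ W) : W = ⊤ := by
  let ef : Module.Basis (ι × κ) K (M.tensor N) := e.tensorProduct f
  have hef : ∀ p, ef p = pureTensor M N (e p.1) (f p.2) := e.tensorProduct_apply' f
  exact eq_top_of_basis_mem ef fun p => by
    rw [hef]
    exact h _ _

theorem finrank_tensor :
    Module.finrank K (M.tensor N) = Module.finrank K M * Module.finrank K N :=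
  Module.finrank_tensorProduct (R := K) (S := K) (M := M) (M' := N)

end

end FDModule

namespace GreenRing

variable {K H : Type u} [Field K] [Ring H] [Bialgebra K H]

theorem cls_eq_of_surjective {M N : FDModule K H} (f : M →ₗ[H] N) (hf : Function.Surjective f)
    (h : Module.finrank K M = Module.finrank K N) : cls M = cls N :=
  cls_congr <| LinearEquiv.ofBijective f
    ⟨(LinearMap.injective_iff_surjective_of_finrank_eq_finrank
      (f := f.restrictScalars K) h).mpr hf, hf⟩

theorem cls_eq_sum_of_iSup_range_eq_top {ι : Type} [Fintype ι] {M : FDModule K H}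
    {N : ι → FDModule K H} (f : ∀ i, N i →ₗ[H] M) (hf : ⨆ i, LinearMap.range (f i) = ⊤)
    (h : Module.finrank K M = ∑ i, Module.finrank K (N i)) : cls M = ∑ i, cls (N i) := by
  classical
  let g : FDModule.pi N →ₗ[H] M := LinearMap.lsum H (fun i => (N i : Type u)) ℕ f
  have hg : Function.Surjective g := by
    refine LinearMap.range_eq_top.mp (top_le_iff.mp (hf ▸ iSup_le fun i => ?_))
    rintro _ ⟨x, rfl⟩
    exact ⟨Pi.single i x, LinearMap.lsum_piSingle (R := H) (φ := fun i => (N i : Type u)) ℕ f i x⟩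
  have hrank : Module.finrank K (FDModule.pi N) = Module.finrank K M :=
    (Module.finrank_pi_fintype K (M := fun i => (N i : Type u))).trans h.symm
  rw [← cls_pi, cls_eq_of_surjective g hg hrank]

end GreenRing

namespace HnZero

noncomputable section

open FDModule GreenRing

variable {K : Type u} [Field K] {n : ℕ} {q : K} [hn : Fact (2 < n)]
  [hq : Fact (IsPrimitiveRoot q n)]

instance neZero_of_fact : NeZero n := ⟨ne_zero_of_fact⟩

theorem simple_eq_oneDim (i j : ZMod n) : simple n q i j = oneDim n q i.val j.val := by
  have h : lift (relations_simple n q i j) = character n q i.val j.val := hom_ext fun g => by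
    cases g <;> simp only [character, lift_gen, genMap, zpow_natCast]
  rw [simple, oneDim, h]

theorem trivial_eq_oneDim : FDModule.trivial K (HnZero n q) = oneDim n q 0 0 := by
  have h : Bialgebra.counitAlgHom K (HnZero n q) = character n q 0 0 := hom_ext fun g => by
    rw [character, lift_gen, zpow_zero]
    exact counit_gen g
  rw [FDModule.trivial, oneDim, h]

section Comul

variable (n q)

theorem comul_a : Coalgebra.comul (R := K) (gen n q .a) =
    gen n q .a ⊗ₜ[K] gen n q .b + 1 ⊗ₜ[K] gen n q .a := comul_gen .a

theorem comul_b : Coalgebra.comul (R := K) (gen n q .b) = gen n q .b ⊗ₜ[K] gen n q .b :=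
  comul_gen .b

theorem comul_c : Coalgebra.comul (R := K) (gen n q .c) = gen n q .c ⊗ₜ[K] gen n q .c :=
  comul_gen .c

theorem comul_d : Coalgebra.comul (R := K) (gen n q .d) =
    gen n q .d ⊗ₜ[K] gen n q .c + 1 ⊗ₜ[K] gen n q .d := comul_gen .d

end Comul

theorem IsWeight.pureTensor {M N : FDModule K (HnZero n q)} {x : M} {y : N} {i j k l : ℤ}
    (hx : IsWeight n q i j x) (hy : IsWeight n q k l y) :
    IsWeight n q (i + k) (j + l) (FDModule.pureTensor M N x y) := by
  have hq0 : q ≠ 0 := hq.out.ne_zero ne_zero_of_fact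
  constructor
  · rw [smul_pureTensor_of_groupLike (comul_b n q), hx.b, hy.b, map_smul, map_smul,
      LinearMap.smul_apply, smul_smul, zpow_add₀ hq0, mul_comm]
  · rw [smul_pureTensor_of_groupLike (comul_c n q), hx.c, hy.c, map_smul, map_smul,
      LinearMap.smul_apply, smul_smul, zpow_add₀ hq0, mul_comm]

variable {i j i' j' : ℤ}

theorem eq_top_of_inducedVec_pureTensor_mem {ι : Type*} {M : FDModule K (HnZero n q)}
    (e : Module.Basis ι K M) {W : Submodule (HnZero n q) ((induced n q i j).tensor M)}
    (h : ∀ p, pureTensor _ M (inducedVec n q i j 0 0) (e p) ∈ W) : W = ⊤ := by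
  have htop : (W.restrictScalars K).comap (pureTensor _ M (inducedVec n q i j 0 0)) = ⊤ :=
    eq_top_of_basis_mem e h
  have hbase (y : M) : pureTensor _ M (inducedVec n q i j 0 0) y ∈ W :=
    htop.ge (Submodule.mem_top (x := y))
  have hb : gen n q .b * gen n q .b ^ (n - 1) = 1 := by
    rw [mul_pow_sub_one ne_zero_of_fact, (relations n q).bn]
  have hc : gen n q .c * gen n q .c ^ (n - 1) = 1 := by
    rw [mul_pow_sub_one ne_zero_of_fact, (relations n q).cn]
  refine eq_top_of_pureTensor_basis_mem (inducedBasis n q i j) e fun p s => ?_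
  rw [inducedBasis_apply, inducedVec_eq_smul]
  exact pureTensor_pow_smul_mem (comul_a n q) hb
    (pureTensor_pow_smul_mem (comul_d n q) hc hbase _) _ _

theorem cls_induced_mul_of_basis {ι : Type} [Fintype ι] {M : FDModule K (HnZero n q)}
    (e : Module.Basis ι K M) {k l : ι → ℤ} (he : ∀ p, IsWeight n q (k p) (l p) (e p)) :
    cls (induced n q i j) * cls M = ∑ p, cls (induced n q (i + k p) (j + l p)) := by
  have hw (p : ι) := (isWeight_inducedVec_zero n q i j).pureTensor (he p)
  have hspan : ⨆ p, LinearMap.range (inducedHom (hw p)) = ⊤ :=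
    eq_top_of_inducedVec_pureTensor_mem e fun p =>
      Submodule.mem_iSup_of_mem p ⟨_, inducedHom_inducedVec_zero (hw p)⟩
  rw [cls_mul]
  refine cls_eq_sum_of_iSup_range_eq_top (fun p => inducedHom (hw p)) hspan ?_
  rw [finrank_tensor, finrank_induced, Module.finrank_eq_card_basis e, mul_comm]
  exact (Finset.sum_const_nat fun p _ => finrank_induced).symm

theorem cls_induced_mul_oneDim :
    cls (induced n q i j) * cls (oneDim n q i' j') = cls (induced n q (i + i') (j + j')) := by
  have hw (x : Unit) : IsWeight n q i' j' (oneBasis n q i' j' x) := by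
    rw [oneBasis_apply]
    exact isWeight_oneVec
  rw [cls_induced_mul_of_basis (oneBasis n q i' j') hw, Fintype.sum_unique]

theorem cls_induced_mul_induced :
    cls (induced n q i j) * cls (induced n q i' j') = ∑ p : Fin n × Fin n,
      cls (induced n q (i + (i' + (p.1 : ℕ) - (p.2 : ℕ))) (j + (j' + (p.1 : ℕ) - (p.2 : ℕ)))) :=
  cls_induced_mul_of_basis (inducedBasis n q i' j') fun p => by
    rw [inducedBasis_apply]
    exact isWeight_inducedVec _ _

theorem cls_oneDim_mul_induced :
    cls (oneDim n q i j) * cls (induced n q i' j') = cls (induced n q (i + i') (j + j')) := by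
  rw [cls_mul]
  let f := inducedHom (isWeight_oneVec.pureTensor (isWeight_inducedVec_zero n q i' j') :
    IsWeight n q (i + i') (j + j') (pureTensor (oneDim n q i j) _ _ _))
  have hf (k l : ℕ) : f (inducedVec n q _ _ k l) =
      pureTensor _ _ (oneVec n q i j) (inducedVec n q i' j' k l) := by
    rw [inducedHom_inducedVec,
      pow_smul_pureTensor_of_smul_eq_zero (comul_d n q) (d_smul_oneVec ..),
      pow_smul_pureTensor_of_smul_eq_zero (comul_a n q) (a_smul_oneVec ..), ← inducedVec_eq_smul]
  refine (cls_eq_of_surjective f (LinearMap.range_eq_top.mp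
    (eq_top_of_pureTensor_basis_mem (oneBasis n q i j) (inducedBasis n q i' j') fun r s => ?_))
    ?_).symm
  · rw [oneBasis_apply, inducedBasis_apply]
    exact ⟨_, hf _ _⟩
  · rw [finrank_tensor, finrank_induced, finrank_induced,
      Module.finrank_eq_card_basis (oneBasis n q i j), Fintype.card_unit, one_mul]

theorem cls_oneDim_mul_oneDim :
    cls (oneDim n q i j) * cls (oneDim n q i' j') = cls (oneDim n q (i + i') (j + j')) := by
  rw [cls_mul]
  let u := pureTensor _ _ (oneVec n q i j) (oneVec n q i' j')
  have ha : gen n q .a • u = 0 := by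
    rw [smul_pureTensor_of_skewPrimitive (comul_a n q), a_smul_oneVec, a_smul_oneVec, map_zero,
      map_zero, LinearMap.zero_apply, add_zero]
  have hd : gen n q .d • u = 0 := by
    rw [smul_pureTensor_of_skewPrimitive (comul_d n q), d_smul_oneVec, d_smul_oneVec, map_zero,
      map_zero, LinearMap.zero_apply, add_zero]
  let f := oneDimHom (isWeight_oneVec.pureTensor isWeight_oneVec) ha hd
  refine (cls_eq_of_surjective f (LinearMap.range_eq_top.mp
    (eq_top_of_pureTensor_basis_mem (oneBasis n q i j) (oneBasis n q i' j') fun r s => ?_))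
    ?_).symm
  · rw [oneBasis_apply, oneBasis_apply]
    exact ⟨_, oneDimHom_oneVec ..⟩
  · rw [finrank_tensor, Module.finrank_eq_card_basis (oneBasis n q i j),
      Module.finrank_eq_card_basis (oneBasis n q i' j'),
      Module.finrank_eq_card_basis (oneBasis n q _ _), Fintype.card_unit, one_mul]

theorem cls_mem_of_projective {R : AddSubgroup (GreenRing K (HnZero n q))}
    (hR : ∀ i j, cls (induced n q i j) ∈ R) (P : FDModule K (HnZero n q))
    [hP : Module.Projective (HnZero n q) P] : cls P ∈ R := by
  induction hr : Module.finrank K P using Nat.strong_induction_on generalizing P with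
  | _ r ih =>
    rcases subsingleton_or_nontrivial P with h | h
    · rw [cls_of_subsingleton]
      exact R.zero_mem
    · obtain ⟨i, j, f, hf⟩ := exists_surjective_induced (n := n) (q := q) P
      let N := FDModule.ofSubmodule (LinearMap.ker f)
      obtain ⟨e⟩ : Nonempty (P ≃ₗ[HnZero n q] N.directSum (induced n q i j)) :=
        FDModule.nonempty_equiv_directSum_ker f hf
      have hrank : r = Module.finrank K N + n * n := by
        rw [← hr, (e.restrictScalars K).finrank_eq, ← finrank_induced (n := n) (q := q)]
        exact Module.finrank_prod
      have hN : Module.Projective (HnZero n q) N :=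
        Module.Projective.of_split (e.symm.toLinearMap ∘ₗ LinearMap.inl _ _ _)
          (LinearMap.fst _ _ _ ∘ₗ e.toLinearMap)
          (LinearMap.ext fun x => congrArg Prod.fst (e.apply_symm_apply (x, 0)))
      have hlt : Module.finrank K N < r := by
        have := NeZero.pos n
        rw [hrank]
        exact Nat.lt_add_of_pos_right (Nat.mul_pos this this)
      rw [cls_congr e, cls_directSum]
      exact R.add_mem (ih _ hlt N rfl) (hR i j)

end

end HnZero

/-! ## The polynomial presentation -/

section Presentation

/-- The relations that define the quotient by `classIdeal n`, for elements of an arbitrary ring. -/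
structure ClassRelations {G : Type*} [Ring G] (n : ℕ) (x y z : G) : Prop where
  x_pow : x ^ n = 1
  y_pow : y ^ n = 1
  z_sq : z ^ 2 = n * ∑ i ∈ Finset.range n, x ^ i * z

/-- The monomials `xⁱ yʲ` and `xⁱ yʲ z` with `i, j < n`. -/
def classMonomial {G : Type*} [Ring G] (n : ℕ) (x y z : G) :
    (Fin n × Fin n) ⊕ (Fin n × Fin n) → G :=
  Sum.elim (fun p => x ^ (p.1 : ℕ) * y ^ (p.2 : ℕ)) fun p => x ^ (p.1 : ℕ) * y ^ (p.2 : ℕ) * z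

theorem map_comp_classMonomial {F G G' : Type*} [Ring G] [Ring G'] [FunLike F G G']
    [RingHomClass F G G'] (f : F) (n : ℕ) (x y z : G) :
    f ∘ classMonomial n x y z = classMonomial n (f x) (f y) (f z) := by
  funext p
  rcases p with p | p <;>
    simp only [classMonomial, Function.comp_apply, Sum.elim_inl, Sum.elim_inr, map_mul, map_pow]

variable {n : ℕ} [NeZero n]

namespace ClassRelations

section Ring

variable {G : Type*} [Ring G] {x y z : G} (h : ClassRelations n x y z)
include h

theorem pow_mul_pow_mem_span (i j : ℕ) :
    x ^ i * y ^ j ∈ Submodule.span ℤ (Set.range (classMonomial n x y z)) := by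
  rw [pow_eq_pow_mod i h.x_pow, pow_eq_pow_mod j h.y_pow]
  exact Submodule.subset_span ⟨.inl (Fin.ofNat n i, Fin.ofNat n j), rfl⟩

theorem pow_mul_pow_mul_mem_span (i j : ℕ) :
    x ^ i * y ^ j * z ∈ Submodule.span ℤ (Set.range (classMonomial n x y z)) := by
  rw [pow_eq_pow_mod i h.x_pow, pow_eq_pow_mod j h.y_pow]
  exact Submodule.subset_span ⟨.inr (Fin.ofNat n i, Fin.ofNat n j), rfl⟩

end Ring

section CommRing

variable {G : Type*} [CommRing G] {x y z : G} (h : ClassRelations n x y z)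
include h

theorem pow_mul_pow_mul_sq_mem_span (i j : ℕ) :
    x ^ i * y ^ j * z ^ 2 ∈ Submodule.span ℤ (Set.range (classMonomial n x y z)) := by
  rw [h.z_sq, mul_left_comm, ← nsmul_eq_mul, Finset.mul_sum]
  refine Submodule.smul_of_tower_mem _ n (Submodule.sum_mem _ fun m _ => ?_)
  rw [← mul_assoc, mul_right_comm (x ^ i), ← pow_add]
  exact h.pow_mul_pow_mul_mem_span _ _

theorem mul_mem_span {t : G} (ht : t = x ∨ t = y ∨ t = z) {w : G}
    (hw : w ∈ Submodule.span ℤ (Set.range (classMonomial n x y z))) :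
    w * t ∈ Submodule.span ℤ (Set.range (classMonomial n x y z)) := by
  refine (Submodule.map_span_le (LinearMap.mulRight ℤ t) _ _).mpr ?_ ⟨w, hw, rfl⟩
  rintro _ ⟨p | p, rfl⟩ <;>
    simp only [classMonomial, Sum.elim_inl, Sum.elim_inr, LinearMap.mulRight_apply] <;>
    rcases ht with rfl | rfl | rfl
  · rw [mul_right_comm, ← pow_succ]
    exact h.pow_mul_pow_mem_span _ _
  · rw [mul_assoc, ← pow_succ]
    exact h.pow_mul_pow_mem_span _ _
  · exact h.pow_mul_pow_mul_mem_span _ _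
  · rw [mul_right_comm, mul_right_comm (t ^ _), ← pow_succ]
    exact h.pow_mul_pow_mul_mem_span _ _
  · rw [mul_right_comm, mul_assoc (x ^ _), ← pow_succ]
    exact h.pow_mul_pow_mul_mem_span _ _
  · rw [mul_assoc, ← sq]
    exact h.pow_mul_pow_mul_sq_mem_span _ _

end CommRing

end ClassRelations

/-- The class of a variable in the quotient by `classIdeal n`. -/
noncomputable abbrev classVar (n : ℕ) (k : Fin 3) : MvPolynomial (Fin 3) ℤ ⧸ classIdeal n :=
  Ideal.Quotient.mk _ (MvPolynomial.X k)

theorem classRelations_classVar (n : ℕ) :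
    ClassRelations n (classVar n 0) (classVar n 1) (classVar n 2) := by
  constructor
  · rw [← map_pow, ← map_one (Ideal.Quotient.mk (classIdeal n)), Ideal.Quotient.eq]
    exact Ideal.subset_span (.inl rfl)
  · rw [← map_pow, ← map_one (Ideal.Quotient.mk (classIdeal n)), Ideal.Quotient.eq]
    exact Ideal.subset_span (.inr (.inl rfl))
  · simp only [← map_pow, ← map_mul, ← map_sum, ← map_natCast (Ideal.Quotient.mk (classIdeal n))]
    rw [Ideal.Quotient.eq]
    exact Ideal.subset_span (.inr (.inr rfl))

theorem span_classMonomial_classVar :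
    Submodule.span ℤ (Set.range (classMonomial n (classVar n 0) (classVar n 1) (classVar n 2))) =
      ⊤ := by
  refine eq_top_iff.mpr fun w _ => ?_
  obtain ⟨p, rfl⟩ := Ideal.Quotient.mk_surjective w
  have h := classRelations_classVar n
  induction p using MvPolynomial.induction_on with
  | C a =>
    have h1 := Submodule.smul_mem _ a (h.pow_mul_pow_mem_span 0 0)
    rwa [pow_zero, pow_zero, mul_one, zsmul_one, ← map_intCast (Ideal.Quotient.mk (classIdeal n))]
      at h1
  | add p p' hp hp' =>
    rw [map_add]
    exact Submodule.add_mem _ (hp trivial) (hp' trivial)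
  | mul_X p k hp =>
    rw [map_mul]
    refine h.mul_mem_span ?_ (hp trivial)
    fin_cases k
    exacts [.inl rfl, .inr (.inl rfl), .inr (.inr rfl)]

namespace ClassRelations

section Lift

variable {R : Type*} [CommRing R] {x y z : R}

omit [NeZero n] in
theorem classIdeal_le_ker (h : ClassRelations n x y z) :
    classIdeal n ≤ RingHom.ker (MvPolynomial.aeval (R := ℤ) ![x, y, z]) := by
  rw [classIdeal, Ideal.span_le]
  rintro _ (rfl | rfl | rfl) <;>
    simp only [SetLike.mem_coe, RingHom.mem_ker, map_sub, map_mul, map_pow, map_sum, map_natCast,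
      map_one, MvPolynomial.aeval_X, sub_eq_zero]
  exacts [h.x_pow, h.y_pow, h.z_sq]

omit [NeZero n] in
/-- The homomorphism from the quotient by `classIdeal n` determined by three elements that satisfy
its relations. -/
noncomputable def lift (h : ClassRelations n x y z) :
    MvPolynomial (Fin 3) ℤ ⧸ classIdeal n →ₐ[ℤ] R :=
  Ideal.Quotient.liftₐ _ (MvPolynomial.aeval ![x, y, z]) fun _ ha => h.classIdeal_le_ker ha

omit [NeZero n] in
theorem lift_classVar (h : ClassRelations n x y z) (k : Fin 3) :
    h.lift (classVar n k) = ![x, y, z] k :=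
  MvPolynomial.aeval_X _ _

theorem injective_lift (h : ClassRelations n x y z)
    (hli : LinearIndependent ℤ (classMonomial n x y z)) : Function.Injective h.lift := by
  refine (injective_iff_map_eq_zero h.lift).mpr fun w hw => ?_
  obtain ⟨c, rfl⟩ := (Submodule.mem_span_range_iff_exists_fun ℤ).mp
    (span_classMonomial_classVar.ge (Submodule.mem_top (x := w)))
  have hv := map_comp_classMonomial h.lift n (classVar n 0) (classVar n 1) (classVar n 2)
  rw [h.lift_classVar, h.lift_classVar, h.lift_classVar] at hv
  have hc : ∑ p, c p • classMonomial n x y z p = 0 := by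
    rw [← hw, map_sum]
    exact Finset.sum_congr rfl fun p _ => by
      rw [map_zsmul, ← Function.comp_apply (f := h.lift), hv]; rfl
  refine Finset.sum_eq_zero fun p _ => ?_
  rw [Fintype.linearIndependent_iff.mp hli c hc p, zero_smul]

omit [NeZero n] in
theorem surjective_lift (h : ClassRelations n x y z) (htop : Subring.closure {x, y, z} = ⊤) :
    Function.Surjective h.lift := by
  have hle : Subring.closure {x, y, z} ≤ h.lift.toRingHom.range := by
    rw [Subring.closure_le]
    rintro _ (rfl | rfl | rfl)
    exacts [⟨_, h.lift_classVar 0⟩, ⟨_, h.lift_classVar 1⟩, ⟨_, h.lift_classVar 2⟩]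
  exact RingHom.range_eq_top.mp (top_le_iff.mp (htop ▸ hle))

end Lift

open scoped IsMulCommutative in
theorem exists_ringEquiv_closure {G : Type*} [Ring G] {x y z : G} (h : ClassRelations n x y z)
    (hxy : Commute x y) (hxz : Commute x z) (hyz : Commute y z)
    (hli : LinearIndependent ℤ (classMonomial n x y z)) :
    ∃ e : MvPolynomial (Fin 3) ℤ ⧸ classIdeal n ≃+* Subring.closure {x, y, z},
      (e (classVar n 0) : G) = x ∧ (e (classVar n 1) : G) = y ∧ (e (classVar n 2) : G) = z := by
  have hcomm : IsMulCommutative (Subring.closure {x, y, z}) :=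
    Subring.isMulCommutative_closure (by
      rintro u (rfl | rfl | rfl) v (rfl | rfl | rfl)
      exacts [rfl, hxy, hxz, hxy.symm, rfl, hyz, hxz.symm, hyz.symm, rfl])
  let x' : Subring.closure {x, y, z} := ⟨x, Subring.subset_closure (.inl rfl)⟩
  let y' : Subring.closure {x, y, z} := ⟨y, Subring.subset_closure (.inr (.inl rfl))⟩
  let z' : Subring.closure {x, y, z} := ⟨z, Subring.subset_closure (.inr (.inr rfl))⟩
  have h' : ClassRelations n x' y' z' :=
    ⟨Subtype.ext h.x_pow, Subtype.ext h.y_pow, Subtype.ext <| by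
      push_cast
      exact h.z_sq⟩
  have hli' : LinearIndependent ℤ (classMonomial n x' y' z') :=
    .of_comp (Subring.closure {x, y, z}).subtype.toIntAlgHom.toLinearMap <| by
      rwa [AlgHom.coe_toLinearMap, map_comp_classMonomial]
  have htop : Subring.closure {x', y', z'} = ⊤ := by
    have hmap : (Subring.closure {x', y', z'}).map (Subring.subtype _) =
        Subring.closure {x, y, z} := by
      rw [RingHom.map_closure, Set.image_insert_eq, Set.image_pair]; rfl
    refine eq_top_iff.mpr fun w _ => ?_
    obtain ⟨v, hv, hvw⟩ := hmap.ge w.2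
    exact Subtype.ext hvw ▸ hv
  refine ⟨RingEquiv.ofBijective h'.lift ⟨h'.injective_lift hli', h'.surjective_lift htop⟩,
    ?_, ?_, ?_⟩
  · exact congrArg Subtype.val (h'.lift_classVar 0)
  · exact congrArg Subtype.val (h'.lift_classVar 1)
  · exact congrArg Subtype.val (h'.lift_classVar 2)

end ClassRelations

end Presentation

/-! ## Ranks and linear independence -/

namespace FDModule

variable {K H : Type u} [Field K] [Ring H] [Algebra K H] {ι : Type*} {M : FDModule K H}

theorem rankOf_eq_zero_of_basis (e : Module.Basis ι K M) {h : H} (hz : ∀ i, h • e i = 0) :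
    M.rankOf h = 0 := by
  have h0 : Algebra.lsmul K K M h = 0 := e.ext hz
  rw [rankOf, h0, LinearMap.range_zero, finrank_bot]

theorem rankOf_eq_one_of_basis (e : Module.Basis ι K M) {h : H} {i : ι} (hi : h • e i ≠ 0)
    (hz : ∀ j, j ≠ i → h • e j = 0) : M.rankOf h = 1 := by
  have hrange : LinearMap.range (Algebra.lsmul K K M h) = K ∙ (h • e i) := by
    refine le_antisymm ?_ ((Submodule.span_singleton_le_iff_mem _ _).mpr ⟨e i, rfl⟩)
    rw [LinearMap.range_eq_map, ← e.span_eq, Submodule.map_span_le]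
    rintro _ ⟨j, rfl⟩
    rcases eq_or_ne j i with rfl | hj
    · exact Submodule.mem_span_singleton_self _
    · rw [Algebra.lsmul_apply, hz j hj]
      exact Submodule.zero_mem _
  rw [rankOf, hrange, finrank_span_singleton hi]

end FDModule

theorem weight_eq_iff {n : ℕ} (p r : Fin n × Fin n) :
    ((n : ℤ) ∣ (p.1 : ℕ) - (r.1 : ℕ) ∧
      (n : ℤ) ∣ ((p.1 : ℕ) + (p.2 : ℕ)) - ((r.1 : ℕ) + (r.2 : ℕ))) ↔ p = r := by
  have heq (i j : Fin n) (h : (n : ℤ) ∣ (i : ℕ) - (j : ℕ)) : i = j :=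
    Fin.ext <| Nat.cast_injective (R := ℤ) <| sub_eq_zero.mp <| Int.eq_zero_of_abs_lt_dvd h <|
      abs_lt.mpr ⟨by omega, by omega⟩
  refine ⟨fun ⟨h1, h2⟩ => Prod.ext (heq _ _ h1) (heq _ _ ?_), ?_⟩
  · rw [add_sub_add_comm] at h2
    exact (dvd_add_right h1).mp h2
  · rintro rfl
    rw [sub_self, sub_self]
    exact ⟨dvd_zero _, dvd_zero _⟩

namespace HnZero

open FDModule GreenRing

noncomputable section

variable {K : Type u} [Field K] {n : ℕ} {q : K}

section Rank

variable [NeZero n] [hq : Fact (IsPrimitiveRoot q n)] {i j : ℤ}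

theorem rankOf_weightProj_oneDim (k l : ℤ) : (oneDim n q i j).rankOf (weightProj n q k l) =
    if (n : ℤ) ∣ i - k ∧ (n : ℤ) ∣ j - l then 1 else 0 := by
  have hsmul (x : Unit) : weightProj n q k l • oneBasis n q i j x =
      if (n : ℤ) ∣ i - k ∧ (n : ℤ) ∣ j - l then oneVec n q i j else 0 := by
    rw [oneBasis_apply, weightProj_smul hq.out isWeight_oneVec]
  split_ifs at hsmul ⊢
  · refine rankOf_eq_one_of_basis (oneBasis n q i j) (i := ()) ?_ fun x hx => (hx rfl).elim
    rw [hsmul]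
    exact oneVec_ne_zero
  · exact rankOf_eq_zero_of_basis (oneBasis n q i j) hsmul

variable (n q) in
/-- The element of `HnZero n q` that maps the generator of `induced n q k l` to a generator of the
socle and annihilates all the other `inducedVec`s. -/
def socleElt (k l : ℤ) : HnZero n q :=
  gen n q .a ^ (n - 1) * gen n q .d ^ (n - 1) * weightProj n q k l

theorem rankOf_socleElt_oneDim (hn : n ≠ 1) (k l : ℤ) :
    (oneDim n q i j).rankOf (socleElt n q k l) = 0 := by
  have hpos : n - 1 ≠ 0 := Nat.sub_ne_zero_of_lt <| Nat.one_lt_iff_ne_zero_and_ne_one.mpr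
    ⟨NeZero.ne n, hn⟩
  refine rankOf_eq_zero_of_basis (oneBasis n q i j) fun x => ?_
  rw [oneBasis_apply, socleElt, mul_smul, weightProj_smul hq.out isWeight_oneVec, smul_ite,
    mul_smul, ← Nat.succ_pred hpos, pow_succ (gen n q .d), mul_smul, d_smul_oneVec, smul_zero,
    smul_zero, smul_zero, ite_self]

theorem a_pow_smul_inducedVec (m k l : ℕ) :
    gen n q .a ^ m • inducedVec n q i j k l = inducedVec n q i j (k + m) l := by
  induction m with
  | zero => rw [pow_zero, one_smul, add_zero]
  | succ m ih => rw [pow_succ', mul_smul, ih, a_smul_inducedVec, add_assoc]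

theorem d_pow_smul_inducedVec (m k l : ℕ) :
    gen n q .d ^ m • inducedVec n q i j k l = q ^ (k * m) • inducedVec n q i j k (l + m) := by
  induction m with
  | zero => rw [pow_zero, one_smul, mul_zero, pow_zero, one_smul, add_zero]
  | succ m ih =>
    rw [pow_succ', mul_smul, ih, smul_algebra_smul_comm, d_smul_inducedVec, smul_smul, ← pow_add,
      add_assoc, mul_add_one]

theorem socleElt_smul_inducedVec_zero (k l : ℤ) : socleElt n q k l • inducedVec n q i j 0 0 =
    if (n : ℤ) ∣ i - k ∧ (n : ℤ) ∣ j - l then inducedVec n q i j (n - 1) (n - 1) else 0 := by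
  rw [socleElt, mul_smul, weightProj_smul hq.out (isWeight_inducedVec_zero n q i j), smul_ite,
    smul_zero, mul_smul, ← inducedVec_eq_smul]

theorem socleElt_smul_inducedVec_of_ne (k l : ℤ) {r s : ℕ} (h : ¬ (r = 0 ∧ s = 0)) :
    socleElt n q k l • inducedVec n q i j r s = 0 := by
  have hv : (gen n q .a ^ (n - 1) * gen n q .d ^ (n - 1)) • inducedVec n q i j r s = 0 := by
    have hz : inducedVec n q i j (r + (n - 1)) (s + (n - 1)) = 0 := gridVec_eq_zero (by omega)
    rw [mul_smul, d_pow_smul_inducedVec, smul_algebra_smul_comm, a_pow_smul_inducedVec, hz,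
      smul_zero]
  rw [socleElt, mul_smul, weightProj_smul hq.out (isWeight_inducedVec r s), smul_ite, smul_zero,
    hv, ite_self]

theorem rankOf_socleElt_induced (k l : ℤ) : (induced n q i j).rankOf (socleElt n q k l) =
    if (n : ℤ) ∣ i - k ∧ (n : ℤ) ∣ j - l then 1 else 0 := by
  have h0 : inducedBasis n q i j 0 = inducedVec n q i j 0 0 := inducedBasis_apply 0
  have hne (p : Fin n × Fin n) (hp : p ≠ 0) : socleElt n q k l • inducedBasis n q i j p = 0 := by
    rw [inducedBasis_apply]
    exact socleElt_smul_inducedVec_of_ne k l fun h => hp (Prod.ext (Fin.ext h.1) (Fin.ext h.2))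
  have hzero := socleElt_smul_inducedVec_zero (n := n) (q := q) (i := i) (j := j) k l
  split_ifs at hzero ⊢
  · refine rankOf_eq_one_of_basis (inducedBasis n q i j) (i := 0) ?_ hne
    have hlast : n - 1 < n := Nat.sub_one_lt (NeZero.ne n)
    rw [h0, hzero]
    exact inducedBasis_apply (q := q) (i := i) (j := j) (⟨n - 1, hlast⟩, ⟨n - 1, hlast⟩) ▸
      (inducedBasis n q i j).ne_zero _
  · refine rankOf_eq_zero_of_basis (inducedBasis n q i j) fun p => ?_
    rcases eq_or_ne p 0 with rfl | hp
    · rw [h0, hzero]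
    · exact hne p hp

end Rank

variable [hn : Fact (2 < n)] [hq : Fact (IsPrimitiveRoot q n)] {i j : ℤ}

theorem cls_oneDim_zero : cls (oneDim n q 0 0) = 1 := by
  rw [← trivial_eq_oneDim, cls_trivial]

theorem cls_oneDim_pow (m : ℕ) : cls (oneDim n q i j) ^ m = cls (oneDim n q (m * i) (m * j)) := by
  induction m with
  | zero => rw [pow_zero, Nat.cast_zero, zero_mul, zero_mul, cls_oneDim_zero]
  | succ m ih =>
    rw [pow_succ, ih, cls_oneDim_mul_oneDim, Nat.cast_succ, add_one_mul, add_one_mul]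

theorem cls_oneDim_pow_self : cls (oneDim n q i j) ^ n = 1 := by
  rw [cls_oneDim_pow, ← cls_oneDim_zero, oneDim_congr] <;>
    exact sub_zero (_ : ℤ) ▸ dvd_mul_right _ _

theorem cls_oneDim_monomial (k l : ℕ) :
    cls (oneDim n q 1 1) ^ k * cls (oneDim n q 0 1) ^ l = cls (oneDim n q k (k + l)) := by
  rw [cls_oneDim_pow, cls_oneDim_pow, cls_oneDim_mul_oneDim, mul_one, mul_one, mul_zero, add_zero]

theorem cls_oneDim_mul_induced_zero :
    cls (oneDim n q i j) * cls (induced n q 0 0) = cls (induced n q i j) := by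
  rw [cls_oneDim_mul_induced, add_zero, add_zero]

theorem cls_induced_congr {i' j' : ℤ} (hi : (n : ℤ) ∣ i - i') (hj : (n : ℤ) ∣ j - j') :
    cls (induced n q i j) = cls (induced n q i' j') := by
  rw [← cls_oneDim_mul_induced_zero, oneDim_congr hi hj, cls_oneDim_mul_induced_zero]

theorem cls_induced_sq : cls (induced n q 0 0) ^ 2 =
    n * ∑ k ∈ Finset.range n, cls (oneDim n q 1 1) ^ k * cls (induced n q 0 0) := by
  have hcongr (k l : Fin n) : cls (induced n q (0 + (0 + (k : ℕ) - (l : ℕ)))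
      (0 + (0 + (k : ℕ) - (l : ℕ)))) =
        cls (induced n q ((k - l : Fin n) : ℕ) ((k - l : Fin n) : ℕ)) := by
    have hdvd : (n : ℤ) ∣ 0 + (0 + (k : ℕ) - (l : ℕ)) - ((k - l : Fin n) : ℕ) := by
      rw [zero_add, zero_add, Fin.intCast_val_sub_eq_sub_add_ite, sub_add_cancel_left, dvd_neg]
      split_ifs
      exacts [dvd_zero _, dvd_rfl]
    exact cls_induced_congr hdvd hdvd
  calc cls (induced n q 0 0) ^ 2
      = ∑ l : Fin n, ∑ k : Fin n,
          cls (induced n q ((k - l : Fin n) : ℕ) ((k - l : Fin n) : ℕ)) := by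
        rw [sq, cls_induced_mul_induced, Fintype.sum_prod_type_right]
        simp only [hcongr]
    _ = ∑ _l : Fin n, ∑ k : Fin n, cls (induced n q (k : ℕ) (k : ℕ)) :=
        Finset.sum_congr rfl fun l _ =>
          (Equiv.subRight l).sum_comp fun k => cls (induced n q (k : ℕ) (k : ℕ))
    _ = n * ∑ k ∈ Finset.range n, cls (oneDim n q 1 1) ^ k * cls (induced n q 0 0) := by
        simp only [cls_oneDim_pow, cls_oneDim_mul_induced_zero, mul_one]
        rw [Finset.sum_const, Finset.card_univ, Fintype.card_fin, nsmul_eq_mul,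
          Fin.sum_univ_eq_sum_range fun k => cls (induced n q k k)]

theorem classRelations_cls : ClassRelations n (cls (oneDim n q 1 1)) (cls (oneDim n q 0 1))
    (cls (induced n q 0 0)) :=
  ⟨cls_oneDim_pow_self, cls_oneDim_pow_self, cls_induced_sq⟩

theorem commute_cls_oneDim {i' j' : ℤ} :
    Commute (cls (oneDim n q i j)) (cls (oneDim n q i' j')) := by
  rw [Commute, SemiconjBy, cls_oneDim_mul_oneDim, cls_oneDim_mul_oneDim, add_comm i, add_comm j]

theorem commute_cls_oneDim_cls_induced {i' j' : ℤ} :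
    Commute (cls (oneDim n q i j)) (cls (induced n q i' j')) := by
  rw [Commute, SemiconjBy, cls_oneDim_mul_induced, cls_induced_mul_oneDim, add_comm i, add_comm j]

theorem classMonomial_cls : classMonomial n (cls (oneDim n q 1 1)) (cls (oneDim n q 0 1))
    (cls (induced n q 0 0)) =
      Sum.elim (fun p => cls (oneDim n q (p.1 : ℕ) ((p.1 : ℕ) + (p.2 : ℕ))))
        fun p => cls (induced n q (p.1 : ℕ) ((p.1 : ℕ) + (p.2 : ℕ))) := by
  simp only [classMonomial, cls_oneDim_monomial, cls_oneDim_mul_induced_zero]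

theorem linearIndependent_classMonomial_cls : LinearIndependent ℤ
    (classMonomial n (cls (oneDim n q 1 1)) (cls (oneDim n q 0 1)) (cls (induced n q 0 0))) := by
  rw [classMonomial_cls, Fintype.linearIndependent_iff]
  intro c hc
  simp only [Fintype.sum_sum_type, Sum.elim_inl, Sum.elim_inr] at hc
  have hn1 : n ≠ 1 := (one_lt_two.trans hn.out).ne'
  have hinduced (r : Fin n × Fin n) : c (.inr r) = 0 := by
    simpa [rankHom_cls, rankOf_socleElt_oneDim hn1, rankOf_socleElt_induced, weight_eq_iff,
      -zsmul_eq_mul] using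
      congrArg (rankHom (socleElt n q (r.1 : ℕ) ((r.1 : ℕ) + (r.2 : ℕ)))) hc
  have honeDim (r : Fin n × Fin n) : c (.inl r) = 0 := by
    simpa [hinduced, rankHom_cls, rankOf_weightProj_oneDim, weight_eq_iff, -zsmul_eq_mul] using
      congrArg (rankHom (weightProj n q (r.1 : ℕ) ((r.1 : ℕ) + (r.2 : ℕ)))) hc
  exact Sum.rec honeDim hinduced

section Subring

variable {R : Subring (GreenRing K (HnZero n q))} (hx : cls (oneDim n q 1 1) ∈ R)
  (hy : cls (oneDim n q 0 1) ∈ R)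
include hx hy

theorem cls_oneDim_mem (i j : ℤ) : cls (oneDim n q i j) ∈ R := by
  have hpos : (0 : ℤ) < n := Nat.cast_pos.mpr (NeZero.pos n)
  obtain ⟨k, -, hk⟩ := Int.existsUnique_equiv_nat i hpos
  obtain ⟨l, -, hl⟩ := Int.existsUnique_equiv_nat (j - k) hpos
  have hl' : (n : ℤ) ∣ j - (k + l) := sub_sub j k l ▸ hl.dvd
  rw [oneDim_congr hk.dvd hl', ← cls_oneDim_monomial]
  exact R.mul_mem (R.pow_mem hx k) (R.pow_mem hy l)

theorem cls_induced_mem (hz : cls (induced n q 0 0) ∈ R) (i j : ℤ) :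
    cls (induced n q i j) ∈ R := by
  rw [← cls_oneDim_mul_induced_zero]
  exact R.mul_mem (cls_oneDim_mem hx hy i j) hz

end Subring

variable (n q) in
theorem projectiveClassRing_eq_closure : projectiveClassRing K (HnZero n q) =
    Subring.closure {cls (oneDim n q 1 1), cls (oneDim n q 0 1), cls (induced n q 0 0)} := by
  apply le_antisymm <;> rw [projectiveClassRing, Subring.closure_le]
  · set R := Subring.closure {cls (oneDim n q 1 1), cls (oneDim n q 0 1), cls (induced n q 0 0)}
    have hx : cls (oneDim n q 1 1) ∈ R := Subring.subset_closure (.inl rfl)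
    have hy : cls (oneDim n q 0 1) ∈ R := Subring.subset_closure (.inr (.inl rfl))
    have hz : cls (induced n q 0 0) ∈ R := Subring.subset_closure (.inr (.inr rfl))
    rintro _ ⟨M, hM | hM, rfl⟩
    · exact cls_mem_of_projective (R := R.toAddSubgroup) (cls_induced_mem hx hy hz) M
    · obtain ⟨i, j, ⟨e⟩⟩ := exists_equiv_oneDim (n := n) (q := q) (M := M)
      exact cls_congr e ▸ cls_oneDim_mem hx hy i j
  · rintro _ (rfl | rfl | rfl)
    · exact Subring.subset_closure ⟨_, .inr (isSimpleModule_oneDim 1 1), rfl⟩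
    · exact Subring.subset_closure ⟨_, .inr (isSimpleModule_oneDim 0 1), rfl⟩
    · exact Subring.subset_closure ⟨_, .inl (projective_induced 0 0), rfl⟩

end

end HnZero

theorem theorem4p9_general {K : Type u} [Field K] (n : ℕ) (q : K) [Fact (2 < n)]
    [Fact (IsPrimitiveRoot q n)] :
    ∃ e : (MvPolynomial (Fin 3) ℤ ⧸ classIdeal n) ≃+* projectiveClassRing K (HnZero n q),
      (e (Ideal.Quotient.mk _ (MvPolynomial.X 0)) : GreenRing K (HnZero n q)) =
        GreenRing.cls (HnZero.simple n q 1 1) ∧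
      (e (Ideal.Quotient.mk _ (MvPolynomial.X 1)) : GreenRing K (HnZero n q)) =
        GreenRing.cls (HnZero.simple n q 0 1) ∧
      (∃ P : FDModule K (HnZero n q), P.IsProjectiveCover (HnZero.simple n q 0 0)) ∧
      ∀ P : FDModule K (HnZero n q), P.IsProjectiveCover (HnZero.simple n q 0 0) →
        (e (Ideal.Quotient.mk _ (MvPolynomial.X 2)) : GreenRing K (HnZero n q)) =
          GreenRing.cls P := by
  have : Fact (1 < n) := ⟨one_lt_two.trans Fact.out⟩
  have hx : HnZero.simple n q 1 1 = HnZero.oneDim n q 1 1 := by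
    rw [HnZero.simple_eq_oneDim, ZMod.val_one, Nat.cast_one]
  have hy : HnZero.simple n q 0 1 = HnZero.oneDim n q 0 1 := by
    rw [HnZero.simple_eq_oneDim, ZMod.val_one, ZMod.val_zero, Nat.cast_one, Nat.cast_zero]
  have htriv : HnZero.simple n q 0 0 = HnZero.oneDim n q 0 0 := by
    rw [HnZero.simple_eq_oneDim, ZMod.val_zero, Nat.cast_zero]
  have hcover := HnZero.isProjectiveCover_induced (n := n) (q := q) (i := 0) (j := 0)
  rw [hx, hy, htriv, HnZero.projectiveClassRing_eq_closure n q]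
  obtain ⟨e, he⟩ := HnZero.classRelations_cls.exists_ringEquiv_closure HnZero.commute_cls_oneDim
    HnZero.commute_cls_oneDim_cls_induced HnZero.commute_cls_oneDim_cls_induced
    (HnZero.linearIndependent_classMonomial_cls (n := n) (q := q))
  refine ⟨e, he.1, he.2.1, ⟨_, hcover⟩, fun P hP => ?_⟩
  obtain ⟨f⟩ := hcover.nonempty_equiv hP
  exact he.2.2.trans (GreenRing.cls_congr f)

theorem theorem4p9 {K : Type u} [Field K] [IsAlgClosed K] (n : ℕ) (q : K) [Fact (2 < n)]
    [Fact (IsPrimitiveRoot q n)] :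
    ∃ e : (MvPolynomial (Fin 3) ℤ ⧸ classIdeal n) ≃+* projectiveClassRing K (HnZero n q),
      (e (Ideal.Quotient.mk _ (MvPolynomial.X 0)) : GreenRing K (HnZero n q)) =
        GreenRing.cls (HnZero.simple n q 1 1) ∧
      (e (Ideal.Quotient.mk _ (MvPolynomial.X 1)) : GreenRing K (HnZero n q)) =
        GreenRing.cls (HnZero.simple n q 0 1) ∧
      (∃ P : FDModule K (HnZero n q), P.IsProjectiveCover (HnZero.simple n q 0 0)) ∧
      ∀ P : FDModule K (HnZero n q), P.IsProjectiveCover (HnZero.simple n q 0 0) →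
        (e (Ideal.Quotient.mk _ (MvPolynomial.X 2)) : GreenRing K (HnZero n q)) =
          GreenRing.cls P :=
  theorem4p9_general n q
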